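/- **Setting.** Fix a set of constructor symbols and a set of function symbols $FS_\Sigma$, each symbol with an arity, and an infinite set $\mathcal V$ of variables. $\mathbf{Term}_\bot$ is the set of terms built from variables, $\bot$, constructor and function symbols; $\mathbf{CTerm}_\bot$ is the subset without function symbols, ordered by the least partial order $\sqsubseteq$ with $\bot\sqsubseteq t$ and $c(\bar s)\sqsubseteq c(\bar t)$ whenever $s_i\sqsubseteq t_i$ for all $i$. A term is *total* if $\bot$ does not occur in it; the maximal elements of $\mathbf{CTerm}_\bot$ are its total terms. A *program rule* is $f(\bar t)\to r\Leftarrow C$, where $\bar t$ is a linear tuple of total constructor terms, $r\in\mathbf{Term}_\bot$, $r\neq\bot$, and $C$ is a finite set of joinability statements $a\bowtie b$ between total terms. A *plain module* $P$ is a set of rules; $exp(P)$ is the set of function symbols defined by some rule of $P$. We write $P\vdash e\to t$ for derivability in the CRWL goal-oriented proof calculus: $e\to\bot$; $X\to X$; $c(\bar e)\to c(\bar t)$ from all $e_i\to t_i$; $f(\bar e)\to t$ ($t\ne\bot$) from all $e_i\to s_i\theta$, $C\theta$ and $r\theta\to t$, for a rule $f(\bar s)\to r\Leftarrow C$ of $P$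 and $\theta:\mathcal V\to\mathbf{CTerm}_\bot$; $a\bowtie b$ from $a\to t$ and $b\to t$ with $t$ a total constructor term. A *term algebra* $\mathcal A$ interprets each function symbol $f$ of arity $n$ as a monotone map $f^{\mathcal A}$ from $\mathbf{CTerm}_\bot^n$ to nonempty down-closed subsets of $\mathbf{CTerm}_\bot$; constructors are interpreted by $c(\bar t)\mapsto\{u\mid u\sqsubseteq c(\bar t)\}$, and $[\![e]\!]^{\mathcal A}$ is the resulting set of values of a term $e$ under the identity valuation. Algebras are ordered pointwise by inclusion, with joins $\sqcup$ given by unions and least element $\bot_\Sigma$ ($f(\bar t)=\{\bot\}$). $\mathcal A$ is *consistent* if $u\theta\in f^{\mathcal A}(\bar t\theta)$ whenever $u\in f^{\mathcal A}(\bar t)$ and $\theta$ is a substitution by total constructor terms. For a program $P$, $T_P(\mathcal A)$ is the algebra in which $f(\bar t)$ consists of $\bot$ and all $u\in[\![r\theta]\!]^{\mathcal A}$, where $f(\bar s)\to r\Leftarrow C$ is a rule of $P$ and $\theta:\mathcal V\to\mathbf{CTerm}_\bot$ is such that $s_i\theta\sqsubseteq t_i$ for all $i$ and, for each $a\bowtie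 b$ in $C$, the set $[\![a\theta]\!]^{\mathcal A}\cap[\![b\theta]\!]^{\mathcal A}$ contains a maximal element. $T_P^\omega(\bot)=\bigsqcup_k T_P^k(\bot)$. **Module expressions.** Expressions are built from names of finite plain modules by union $E_1\cup E_2$, deletion $E\setminus\sigma$ of a set $\sigma$ of function symbols, renaming $\rho(E)$ by an arity-preserving map $\rho:FS_\Sigma\to FS_\Sigma$ (not necessarily injective), and closure $\overline E$. Each expression denotes a plain module: union of rules; removal of the rules defining symbols of $\sigma$; application of $\rho$ to all rules; and, for the closure of $P$, the set of canonical rewrite rules $crr(f(\bar t),r)$ for all $f\in exp(P)$, $t_i,r\in\mathbf{CTerm}_\bot$, $r\ne\bot$, with $P\vdash f(\bar t)\to r$. Here $crr(f(\bar t),r)$ is the rule $f(\bar t')\to r\Leftarrow C$ where $\bar t'$ is obtained from $\bar t$ by replacing each occurrence of $\bot$ or of a repeated variable by a fresh variable, and $C$ consists of $X\bowtie Y$ for each occurrence of a repeated variable $X$ that was replaced by $Y$, and of $X\bowtie X$ for each variable $X$ that is in $r$ or occurs exactly once in $\bar t$. $T_E$ is the transformer $T$ of the plain module denoted by $E$.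 **Structured modules.** Let $\Omega$ be the set of module expressions and let $\overline\Sigma$ add to $\Sigma$ a labeled function symbol $L.f$ for all $L\in\Omega$, $f\in FS_\Sigma$. A *structured module* consists of a set $R_V$ of rules over $\Sigma$, a set $R_B$ of bridge rules $f(\bar X)\to L.g(\bar X)$, and a set $R_H$ of rules whose function symbols are all labeled, such that every $L.g$ in a bridge rule has a defining rule in $R_H$; its exported symbols are those with a rule in $R_V\cup R_B$. The implementation $\iota(E)$ is defined recursively: a named module $P$ gives $R_V=P$, $R_B=R_H=\emptyset$; unions are componentwise; deletion and renaming act on visible symbols only (so leave $R_H$ unchanged); and if $\iota(E)$ has parts $R_V,R_B,R_H$, then $\iota(\overline E)$ has no visible rules, one bridge rule $f(\bar X)\to E.f(\bar X)$ for each exported symbol $f$ of $\iota(E)$, and hidden rules $\tau_E(R_V\cup R_B)\cup R_H$, where $\tau_E$ replaces each visible function symbol $f$ by $E.f$ and keeps labeled symbols. For a structured module $M$ and a term algebra $\mathcal A$ over $\Sigma$, $$U_M(\mathcal A)=T_{R_V\cup R_B}\bigl(T^\omega_{R_H}(\bot_{\overline\Sigma})\sqcup\overline{\mathcal A}\bigr)\big|_\Sigma,$$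 where $\overline{\mathcal A}$ extends $\mathcal A$ by $L.f(\bar t)=\{\bot\}$ and $|_\Sigma$ forgets the labeled symbols. **Theorem.** For every module expression $E$ built from finite plain modules, $\iota(E)$ is a finite structured module (finitely many rules), $U_{\iota(E)}$ maps consistent term algebras to consistent term algebras, and $$T_E(\mathcal A)=U_{\iota(E)}(\mathcal A)$$ for every term algebra $\mathcal A$ over $\Sigma$ (in particular for every consistent one); that is, $T_E=U_{\iota(E)}$. -/

import Mathlib

universe u v w x

namespace CRWL

/-! ### Constructor terms

A signature is given by its families `C n` (constructor symbols `DS^n`) and `F n` (function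
symbols `FS^n`) of symbols of arity `n`; `V` is the set of variables. -/

/-- Partial constructor terms `CTerm_⊥`. They do not depend on the function symbols. -/
inductive CTerm (C : ℕ → Type u) (V : Type w) : Type (max u w) where
  | bot : CTerm C V
  | var (X : V) : CTerm C V
  | con {n : ℕ} (c : C n) (ts : Fin n → CTerm C V) : CTerm C V

namespace CTerm

variable {C : ℕ → Type u} {V : Type w}

/-- Terms without `⊥`. -/
def Total : CTerm C V → Prop
  | bot => False
  | var _ => True
  | con _ ts => ∀ i, Total (ts i)

/-- The set of variables of a term. -/
def vars : CTerm C V → Set V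
  | bot => ∅
  | var X => {X}
  | con _ ts => ⋃ i, vars (ts i)

open Classical in
/-- The number of occurrences of the variable `X` in a term. -/
noncomputable def occ (X : V) : CTerm C V → ℕ
  | bot => 0
  | var Y => if Y = X then 1 else 0
  | con _ ts => ∑ i, occ X (ts i)

/-- Application of a partial C-substitution. -/
def subst (θ : V → CTerm C V) : CTerm C V → CTerm C V
  | bot => bot
  | var X => θ X
  | con c ts => con c fun i => subst θ (ts i)

/-- The approximation ordering. -/
inductive Approx : CTerm C V → CTerm C V → Prop where
  | bot (t : CTerm C V) : Approx CTerm.bot t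
  | var (X : V) : Approx (CTerm.var X) (CTerm.var X)
  | con {n : ℕ} (c : C n) (ss ts : Fin n → CTerm C V) (h : ∀ i, Approx (ss i) (ts i)) :
      Approx (CTerm.con c ss) (CTerm.con c ts)

theorem Approx.refl : ∀ t : CTerm C V, Approx t t
  | CTerm.bot => Approx.bot _
  | CTerm.var X => Approx.var X
  | CTerm.con c ts => Approx.con c ts ts fun i => Approx.refl (ts i)

theorem Approx.trans {s t r : CTerm C V} (h₁ : Approx s t) (h₂ : Approx t r) : Approx s r := by
  induction h₁ generalizing r with
  | bot t => exact Approx.bot _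
  | var X => exact h₂
  | con c ss ts h ih =>
    cases h₂ with
    | con _ _ rs h' => exact Approx.con c ss rs fun i => ih i (h' i)

theorem Approx.antisymm {s t : CTerm C V} (h₁ : Approx s t) (h₂ : Approx t s) : s = t := by
  induction h₁ with
  | bot t => cases h₂; rfl
  | var X => rfl
  | con c ss ts h ih =>
    cases h₂ with
    | con _ _ _ h' => exact congrArg _ (funext fun i => ih i (h' i))

instance : PartialOrder (CTerm C V) where
  le := Approx
  le_refl := Approx.refl
  le_trans _ _ _ := Approx.trans
  le_antisymm _ _ := Approx.antisymm

theorem bot_le' (t : CTerm C V) : bot ≤ t := Approx.bot t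

theorem vars_finite : ∀ t : CTerm C V, t.vars.Finite
  | bot => Set.finite_empty
  | var X => Set.finite_singleton X
  | con _ ts => Set.finite_iUnion fun i => vars_finite (ts i)

theorem occ_eq_zero {X : V} : ∀ {t : CTerm C V}, X ∉ t.vars → occ X t = 0
  | bot, _ => rfl
  | var Y, h => if_neg fun e => h (by simp [vars, e])
  | con _ ts, h => Finset.sum_eq_zero fun i _ =>
      occ_eq_zero fun hi => h (Set.mem_iUnion.2 ⟨i, hi⟩)

end CTerm

/-! ### Terms -/

/-- Partial terms `Term_⊥` over the signature `(C, F)`. -/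
inductive Term (C : ℕ → Type u) (F : ℕ → Type v) (V : Type w) : Type (max u v w) where
  | bot : Term C F V
  | var (X : V) : Term C F V
  | con {n : ℕ} (c : C n) (es : Fin n → Term C F V) : Term C F V
  | fn {n : ℕ} (f : F n) (es : Fin n → Term C F V) : Term C F V

namespace Term

variable {C : ℕ → Type u} {F : ℕ → Type v} {V : Type w}

/-- Fully defined terms (without `⊥`). -/
def Total : Term C F V → Prop
  | bot => False
  | var _ => True
  | con _ es => ∀ i, Total (es i)
  | fn _ es => ∀ i, Total (es i)

/-- Inclusion of constructor terms in terms. -/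
def ofCTerm : CTerm C V → Term C F V
  | CTerm.bot => bot
  | CTerm.var X => var X
  | CTerm.con c ts => con c fun i => ofCTerm (ts i)

/-- Application of a partial C-substitution. -/
def subst (θ : V → CTerm C V) : Term C F V → Term C F V
  | bot => bot
  | var X => ofCTerm (θ X)
  | con c es => con c fun i => subst θ (es i)
  | fn f es => fn f fun i => subst θ (es i)

/-- `f` (of arity `n`) occurs in the term. -/
def Occurs {n : ℕ} (f : F n) : Term C F V → Prop
  | bot => False
  | var _ => False
  | con _ es => ∃ i, Occurs f (es i)
  | @fn _ _ _ m g es => (⟨m, g⟩ : Σ k, F k) = ⟨n, f⟩ ∨ ∃ i, Occurs f (es i)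

/-- Replacement of function symbols along an arity-preserving mapping. -/
def map {F' : ℕ → Type x} (φ : ∀ n, F n → F' n) : Term C F V → Term C F' V
  | bot => bot
  | var X => var X
  | con c es => con c fun i => map φ (es i)
  | fn f es => fn (φ _ f) fun i => map φ (es i)

theorem Total.map {F' : ℕ → Type x} (φ : ∀ n, F n → F' n) :
    ∀ {e : Term C F V}, e.Total → (e.map φ).Total
  | bot, h => h
  | var _, h => h
  | con _ _, h => fun i => Total.map φ (h i)
  | fn _ _, h => fun i => Total.map φ (h i)

end Term

/-! ### Rules, programs and derivations -/

/-- Rules `f(t̄) → r ⇐ C` defining the function symbol `f`: `t̄` is a linear tuple of fully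
defined constructor terms, `r ≠ ⊥`, and `C` is a finite set of joinability statements `a ⋈ b`
(represented by the pairs `(a, b)`) between fully defined terms. -/
@[ext]
structure Rule (C : ℕ → Type u) (F : ℕ → Type v) (V : Type w) {n : ℕ} (f : F n) where
  args : Fin n → CTerm C V
  rhs : Term C F V
  cond : Set (Term C F V × Term C F V)
  args_total : ∀ i, (args i).Total
  args_linear : ∀ X, ∑ i, (args i).occ X ≤ 1
  rhs_ne_bot : rhs ≠ Term.bot
  cond_finite : cond.Finite
  cond_total : ∀ p ∈ cond, p.1.Total ∧ p.2.Total

/-- Subsignatures of function symbols. -/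
abbrev SubSig (F : ℕ → Type v) := ∀ n, Set (F n)

/-- Function symbol renamings. -/
abbrev Renaming (F : ℕ → Type v) := ∀ n, F n → F n

/-- Programs, i.e. sets of rules. A plain module is identified with its body, because its exported
signature `exp` and its parameter signature `par` are determined by its body. -/
abbrev Program (C : ℕ → Type u) (F : ℕ → Type v) (V : Type w) :=
  Set (Σ (n : ℕ) (f : F n), Rule C F V f)

variable {C : ℕ → Type u} {F : ℕ → Type v} {V : Type w}

/-- Replacement of function symbols in a rule. -/
def Rule.map {F' : ℕ → Type x} (φ : ∀ n, F n → F' n) {n : ℕ} {f : F n} (R : Rule C F V f) :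
    Rule C F' V (φ n f) where
  args := R.args
  rhs := R.rhs.map φ
  cond := (fun p => (p.1.map φ, p.2.map φ)) '' R.cond
  args_total := R.args_total
  args_linear := R.args_linear
  rhs_ne_bot := by
    have h := R.rhs_ne_bot
    cases hr : R.rhs <;> simp_all [Term.map]
  cond_finite := R.cond_finite.image _
  cond_total := by
    rintro _ ⟨p, hp, rfl⟩
    exact ⟨(R.cond_total p hp).1.map φ, (R.cond_total p hp).2.map φ⟩

/-- Replacement of function symbols in a program. -/
def Program.map {F' : ℕ → Type x} (φ : ∀ n, F n → F' n) (P : Program C F V) : Program C F' V :=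
  (fun R => ⟨R.1, φ R.1 R.2.1, R.2.2.map φ⟩) '' P

/-- Function symbols with a definition rule. -/
def Program.exp (P : Program C F V) : SubSig F :=
  fun n => {f | ∃ R : Rule C F V f, ⟨n, f, R⟩ ∈ P}

/-- Function symbols occurring in the right hand side or the condition of some rule. -/
def Program.invoked (P : Program C F V) : SubSig F :=
  fun _ => {f | ∃ R ∈ P, R.2.2.rhs.Occurs f ∨
    ∃ p ∈ R.2.2.cond, p.1.Occurs f ∨ p.2.Occurs f}

/-- Function symbols that are invoked but not defined. -/
def Program.par (P : Program C F V) : SubSig F := fun n => P.invoked n \ P.exp n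

/-- Deletion of a signature. -/
def Program.delete (P : Program C F V) (σ : SubSig F) : Program C F V :=
  {R ∈ P | R.2.1 ∉ σ R.1}

/-- Atomic formulas: approximation statements `e → t` and joinability statements `a ⋈ b`. Only
reduction statements with right hand side in `CTerm_⊥` are derivable in the calculus. -/
inductive Formula (C : ℕ → Type u) (F : ℕ → Type v) (V : Type w) : Type (max u v w) where
  | red (e : Term C F V) (t : CTerm C V) : Formula C F V
  | join (a b : Term C F V) : Formula C F V

/-- The Goal-Oriented Proof Calculus. -/
inductive Derives (P : Program C F V) : Formula C F V → Prop where
  | Bo (e : Term C F V) : Derives P (.red e CTerm.bot)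
  | RR (X : V) : Derives P (.red (Term.var X) (CTerm.var X))
  | DS {n : ℕ} (c : C n) (es : Fin n → Term C F V) (ts : Fin n → CTerm C V)
      (h : ∀ i, Derives P (.red (es i) (ts i))) :
      Derives P (.red (Term.con c es) (CTerm.con c ts))
  | OR {n : ℕ} (f : F n) (es : Fin n → Term C F V) (t : CTerm C V) (R : Rule C F V f)
      (hR : ⟨n, f, R⟩ ∈ P) (θ : V → CTerm C V)
      (hargs : ∀ i, Derives P (.red (es i) ((R.args i).subst θ)))
      (hcond : ∀ p ∈ R.cond, Derives P (.join (p.1.subst θ) (p.2.subst θ)))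
      (hrhs : Derives P (.red (R.rhs.subst θ) t)) (ht : t ≠ CTerm.bot) :
      Derives P (.red (Term.fn f es) t)
  | Jo (a b : Term C F V) (t : CTerm C V) (ht : t.Total)
      (ha : Derives P (.red a t)) (hb : Derives P (.red b t)) : Derives P (.join a b)

/-! ### Canonical rewrite rules and closure -/

/-- An injective supply of variables outside the finite set `S`, indexed by positions (paths). -/
noncomputable def fresh [Infinite V] {S : Set V} (hS : S.Finite) (p : List ℕ) : V :=
  (@Infinite.natEmbedding _ hS.infinite_compl.to_subtype (Encodable.encode p) : (Sᶜ : Set V))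

theorem fresh_notMem [Infinite V] {S : Set V} (hS : S.Finite) (p : List ℕ) : fresh hS p ∉ S :=
  (@Infinite.natEmbedding _ hS.infinite_compl.to_subtype (Encodable.encode p) : (Sᶜ : Set V)).2

theorem fresh_injective [Infinite V] {S : Set V} (hS : S.Finite) :
    Function.Injective (fresh hS) := by
  intro p q h
  exact Encodable.encode_injective
    ((@Infinite.natEmbedding _ hS.infinite_compl.to_subtype).injective (Subtype.ext h))

/-- `X` occurs more than once in the tuple. -/
def Repeated {n : ℕ} (ts : Fin n → CTerm C V) (X : V) : Prop := 2 ≤ ∑ i, (ts i).occ X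

/-- All variables of a tuple and a term. -/
def allVars {n : ℕ} (ts : Fin n → CTerm C V) (r : CTerm C V) : Set V :=
  (⋃ i, (ts i).vars) ∪ r.vars

theorem allVars_finite {n : ℕ} (ts : Fin n → CTerm C V) (r : CTerm C V) :
    (allVars ts r).Finite :=
  (Set.finite_iUnion fun i => (ts i).vars_finite).union r.vars_finite

open Classical in
/-- Substitution of the variable `fr p` for each occurrence, at any position `p`, of `⊥` or of a
variable satisfying `rep`. -/
noncomputable def linearize (fr : List ℕ → V) (rep : V → Prop) :
    CTerm C V → List ℕ → CTerm C V
  | CTerm.bot, p => CTerm.var (fr p)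
  | CTerm.var X, p => if rep X then CTerm.var (fr p) else CTerm.var X
  | CTerm.con c ts, p => CTerm.con c fun i => linearize fr rep (ts i) (p ++ [(i : ℕ)])

/-- The statements `X ⋈ fr p` for the occurrences, at positions `p`, of variables `X` satisfying
`rep`. -/
def links (fr : List ℕ → V) (rep : V → Prop) :
    CTerm C V → List ℕ → Set (Term C F V × Term C F V)
  | CTerm.bot, _ => ∅
  | CTerm.var X, p => {q | rep X ∧ q = (Term.var X, Term.var (fr p))}
  | CTerm.con _ ts, p => ⋃ i, links fr rep (ts i) (p ++ [(i : ℕ)])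

theorem linearize_total (fr : List ℕ → V) (rep : V → Prop) :
    ∀ (t : CTerm C V) (p : List ℕ), (linearize fr rep t p).Total
  | CTerm.bot, _ => trivial
  | CTerm.var X, p => by
      unfold linearize
      split_ifs <;> trivial
  | CTerm.con _ ts, p => fun i => linearize_total fr rep (ts i) _

theorem links_finite (fr : List ℕ → V) (rep : V → Prop) :
    ∀ (t : CTerm C V) (p : List ℕ), (links (F := F) fr rep t p).Finite
  | CTerm.bot, _ => Set.finite_empty
  | CTerm.var X, p => (Set.finite_singleton (Term.var X, Term.var (fr p))).subset fun _ h => h.2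
  | CTerm.con _ ts, _ => Set.finite_iUnion fun i => links_finite fr rep (ts i) _

theorem links_total (fr : List ℕ → V) (rep : V → Prop) :
    ∀ (t : CTerm C V) (p : List ℕ), ∀ q ∈ links (F := F) fr rep t p, q.1.Total ∧ q.2.Total
  | CTerm.bot, _, _, h => h.elim
  | CTerm.var X, p, q, h => by
      obtain ⟨-, rfl⟩ := h
      exact ⟨trivial, trivial⟩
  | CTerm.con _ ts, _, q, h => by
      obtain ⟨i, hi⟩ := Set.mem_iUnion.1 h
      exact links_total fr rep (ts i) _ q hi

theorem occ_linearize_le {fr : List ℕ → V} {rep : V → Prop} {X : V} (hX : ∀ p, fr p ≠ X)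
    (t : CTerm C V) (p : List ℕ) : (linearize fr rep t p).occ X ≤ t.occ X := by
  induction t generalizing p with
  | bot => simp [linearize, CTerm.occ, hX]
  | var Y =>
    unfold linearize
    split_ifs <;> simp [CTerm.occ, hX]
  | con c ts ih => exact Finset.sum_le_sum fun i _ => ih i _

theorem occ_linearize_rep {fr : List ℕ → V} {rep : V → Prop} {X : V} (hX : ∀ p, fr p ≠ X)
    (hr : rep X) (t : CTerm C V) (p : List ℕ) : (linearize fr rep t p).occ X = 0 := by
  induction t generalizing p with
  | bot => simp [linearize, CTerm.occ, hX]
  | var Y =>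
    unfold linearize
    split_ifs with h
    · simp [CTerm.occ, hX]
    · have : Y ≠ X := fun e => h (e ▸ hr)
      simp [CTerm.occ, this]
  | con c ts ih => exact Finset.sum_eq_zero fun i _ => ih i _

theorem sum_le_one_of_prefix {n : ℕ} (a : Fin n → ℕ) (p q : List ℕ) (h₁ : ∀ i, a i ≤ 1)
    (h₀ : ∀ i : Fin n, ¬ (p ++ [(i : ℕ)]) <+: q → a i = 0) : ∑ i, a i ≤ 1 := by
  by_cases h : ∃ i : Fin n, (p ++ [(i : ℕ)]) <+: q
  · obtain ⟨i, hi⟩ := h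
    rw [Finset.sum_eq_single i]
    · exact h₁ i
    · intro j _ hj
      refine h₀ j fun hj' => hj ?_
      have := List.prefix_of_prefix_length_le hj' hi (by simp)
      have := this.eq_of_length (by simp)
      exact Fin.ext (by simpa using this)
    · simp
  · rw [Finset.sum_eq_zero fun i _ => h₀ i fun hi => h ⟨i, hi⟩]
    exact zero_le_one

theorem occ_linearize_fresh {fr : List ℕ → V} (hfr : Function.Injective fr) {rep : V → Prop}
    (q : List ℕ) (t : CTerm C V) (ht : fr q ∉ t.vars) (p : List ℕ) :
    (linearize fr rep t p).occ (fr q) ≤ 1 ∧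
      (¬ p <+: q → (linearize fr rep t p).occ (fr q) = 0) := by
  induction t generalizing p with
  | bot =>
    refine ⟨by simp only [linearize, CTerm.occ]; split_ifs <;> simp, fun h => ?_⟩
    exact if_neg fun e => h (by rw [hfr e])
  | var Y =>
    have hY : Y ≠ fr q := fun e => ht (by simp [CTerm.vars, e])
    unfold linearize
    by_cases hr : rep Y
    · rw [if_pos hr]
      refine ⟨by simp only [CTerm.occ]; split_ifs <;> simp, fun h => ?_⟩
      exact if_neg fun e => h (by rw [hfr e])
    · rw [if_neg hr]
      simp [CTerm.occ, hY]
  | con c ts ih =>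
    have hts : ∀ i, fr q ∉ (ts i).vars := fun i hi => ht (Set.mem_iUnion.2 ⟨i, hi⟩)
    refine ⟨sum_le_one_of_prefix _ p q (fun i => (ih i (hts i) _).1)
      (fun i => (ih i (hts i) _).2), fun h => Finset.sum_eq_zero fun i _ => ?_⟩
    exact (ih i (hts i) _).2 fun h' => h ((List.prefix_append _ _).trans h')

/-- The canonical rewrite rule that reduces `f(t̄)` to `r`. -/
noncomputable def crr [Infinite V] {n : ℕ} (f : F n) (ts : Fin n → CTerm C V) (r : CTerm C V)
    (hr : r ≠ CTerm.bot) : Rule C F V f where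
  args i := linearize (fresh (allVars_finite ts r)) (Repeated ts) (ts i) [(i : ℕ)]
  rhs := Term.ofCTerm r
  cond := (⋃ i : Fin n, links (fresh (allVars_finite ts r)) (Repeated ts) (ts i) [(i : ℕ)]) ∪
    (fun X => (Term.var X, Term.var X)) '' {X ∈ allVars ts r | X ∈ r.vars ∨ ¬ Repeated ts X}
  args_total i := linearize_total _ _ _ _
  args_linear X := by
    by_cases hX : ∃ q, fresh (allVars_finite ts r) q = X
    · obtain ⟨q, rfl⟩ := hX
      have hn : ∀ i, fresh (allVars_finite ts r) q ∉ (ts i).vars := fun i hi =>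
        fresh_notMem (allVars_finite ts r) q (Or.inl (Set.mem_iUnion.2 ⟨i, hi⟩))
      exact sum_le_one_of_prefix _ [] q
        (fun i => (occ_linearize_fresh (fresh_injective _) q _ (hn i) _).1)
        (fun i => (occ_linearize_fresh (fresh_injective _) q _ (hn i) _).2)
    · push Not at hX
      by_cases hR : Repeated ts X
      · rw [Finset.sum_eq_zero fun i _ => occ_linearize_rep hX hR (ts i) _]
        exact zero_le_one
      · exact (Finset.sum_le_sum fun i _ => occ_linearize_le hX (ts i) _).trans
          (Nat.lt_succ_iff.1 (not_le.1 hR))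
  rhs_ne_bot := by cases r <;> simp_all [Term.ofCTerm]
  cond_finite := (Set.finite_iUnion fun i => links_finite _ _ _ _).union
    (((allVars_finite ts r).subset fun _ h => h.1).image _)
  cond_total := by
    rintro q (hq | ⟨X, -, rfl⟩)
    · obtain ⟨i, hi⟩ := Set.mem_iUnion.1 hq
      exact links_total _ _ _ _ q hi
    · exact ⟨trivial, trivial⟩

/-- Closure of a module with respect to a signature. -/
def Program.closureWrt [Infinite V] (P : Program C F V) (σ : SubSig F) : Program C F V :=
  {R | ∃ (n : ℕ) (f : F n) (ts : Fin n → CTerm C V) (r : CTerm C V) (hr : r ≠ CTerm.bot),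
    f ∈ σ n ∧ Derives P (.red (Term.fn f fun i => Term.ofCTerm (ts i)) r) ∧
      R = ⟨n, f, crr f ts r hr⟩}

/-- Closure with respect to the whole exported signature. -/
def Program.closure [Infinite V] (P : Program C F V) : Program C F V := P.closureWrt P.exp

/-! ### Term algebras and the algebra transformer of a program -/

/-- CRWL-term algebras: monotonic mappings from tuples of partial constructor terms to cones, for
each function symbol (the interpretation of constructor symbols is fixed). -/
@[ext]
structure TAlg (C : ℕ → Type u) (F : ℕ → Type v) (V : Type w) where
  interp : ∀ {n : ℕ}, F n → (Fin n → CTerm C V) → Set (CTerm C V)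
  nonempty : ∀ {n : ℕ} (f : F n) (ts : Fin n → CTerm C V), (interp f ts).Nonempty
  isLowerSet : ∀ {n : ℕ} (f : F n) (ts : Fin n → CTerm C V), IsLowerSet (interp f ts)
  mono : ∀ {n : ℕ} (f : F n), Monotone (interp f)

namespace TAlg

/-- Consistency: `f(t̄)θ ⊆ f(t̄θ)` for all total C-substitutions `θ`. -/
def Consistent (A : TAlg C F V) : Prop :=
  ∀ {n : ℕ} (f : F n) (ts : Fin n → CTerm C V) (θ : V → CTerm C V), (∀ X, (θ X).Total) →
    (fun u => u.subst θ) '' A.interp f ts ⊆ A.interp f fun i => (ts i).subst θ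

/-- The bottom algebra: `f(t̄) = {⊥}`. -/
def bot : TAlg C F V where
  interp _ _ := Set.Iic CTerm.bot
  nonempty _ _ := Set.nonempty_Iic
  isLowerSet _ _ := isLowerSet_Iic _
  mono _ := monotone_const

/-- Least upper bound of two algebras. -/
def sup (A B : TAlg C F V) : TAlg C F V where
  interp f ts := A.interp f ts ∪ B.interp f ts
  nonempty f ts := (A.nonempty f ts).inl
  isLowerSet f ts := (A.isLowerSet f ts).union (B.isLowerSet f ts)
  mono f _ _ h := Set.union_subset_union (A.mono f h) (B.mono f h)

/-- Least upper bound of a sequence of algebras. -/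
def seqSup (A : ℕ → TAlg C F V) : TAlg C F V where
  interp f ts := ⋃ k, (A k).interp f ts
  nonempty f ts := ((A 0).nonempty f ts).mono (Set.subset_iUnion (fun k => (A k).interp f ts) 0)
  isLowerSet f ts := isLowerSet_iUnion fun k => (A k).isLowerSet f ts
  mono f _ _ h := Set.iUnion_mono fun k => (A k).mono f h

/-- Evaluation of a term under a valuation. -/
def eval (A : TAlg C F V) (η : V → CTerm C V) : Term C F V → Set (CTerm C V)
  | Term.bot => Set.Iic CTerm.bot
  | Term.var X => Set.Iic (η X)
  | Term.con c es => {u | ∃ ts : Fin _ → CTerm C V,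
      (∀ i, ts i ∈ eval A η (es i)) ∧ u ∈ Set.Iic (CTerm.con c ts)}
  | Term.fn f es => {u | ∃ ts : Fin _ → CTerm C V,
      (∀ i, ts i ∈ eval A η (es i)) ∧ u ∈ A.interp f ts}

theorem isLowerSet_eval (A : TAlg C F V) (η : V → CTerm C V) (e : Term C F V) :
    IsLowerSet (A.eval η e) := by
  cases e with
  | bot => exact isLowerSet_Iic _
  | var X => exact isLowerSet_Iic _
  | con c es =>
    rintro a b hba ⟨ts, h, ha⟩
    exact ⟨ts, h, le_trans hba ha⟩
  | fn f es =>
    rintro a b hba ⟨ts, h, ha⟩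
    exact ⟨ts, h, A.isLowerSet f ts hba ha⟩

/-- Satisfaction of a joinability statement under a valuation. -/
def Joinable (A : TAlg C F V) (η : V → CTerm C V) (a b : Term C F V) : Prop :=
  ∃ t ∈ A.eval η a ∩ A.eval η b, IsMax t

end TAlg

/-- The algebra transformer `T_P` of a program `P`; the identity valuation is `CTerm.var`. -/
def Program.T (P : Program C F V) (A : TAlg C F V) : TAlg C F V where
  interp {n} f ts :=
    {u | ∃ (R : Rule C F V f) (θ : V → CTerm C V), (⟨n, f, R⟩ : Σ m, Σ g : F m, Rule C F V g) ∈ P ∧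
      (∀ i, (R.args i).subst θ ≤ ts i) ∧
      (∀ p ∈ R.cond, A.Joinable CTerm.var (p.1.subst θ) (p.2.subst θ)) ∧
      u ∈ A.eval CTerm.var (R.rhs.subst θ)} ∪ {CTerm.bot}
  nonempty _ _ := ⟨CTerm.bot, Or.inr rfl⟩
  isLowerSet f ts := by
    rintro a b hba (⟨R, θ, hR, h, hc, ha⟩ | rfl)
    · exact Or.inl ⟨R, θ, hR, h, hc, A.isLowerSet_eval _ _ hba ha⟩
    · exact Or.inr (le_antisymm hba (CTerm.bot_le' b))
  mono f ts ts' hts := by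
    rintro a (⟨R, θ, hR, h, hc, ha⟩ | ha)
    · exact Or.inl ⟨R, θ, hR, fun i => (h i).trans (hts i), hc, ha⟩
    · exact Or.inr ha

/-- `T_P^ω(⊥)`, the least upper bound of the chain `⊥ ⊑ T_P(⊥) ⊑ T_P(T_P(⊥)) ⊑ …`. -/
def Program.Tω (P : Program C F V) : TAlg C F V := TAlg.seqSup fun k => P.T^[k] TAlg.bot

/-! ### Module expressions and the flat modules they denote -/

/-- Module expressions over a set `N` of module names. -/
inductive ModExpr (N : Type x) (F : ℕ → Type v) : Type (max v x) where
  | name (a : N) : ModExpr N F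
  | union (E₁ E₂ : ModExpr N F) : ModExpr N F
  | delete (E : ModExpr N F) (σ : SubSig F) : ModExpr N F
  | rename (ρ : Renaming F) (E : ModExpr N F) : ModExpr N F
  | closure (E : ModExpr N F) : ModExpr N F

/-- The plain module denoted by an expression when the name `a` denotes the module `Γ a`. -/
def ModExpr.flat {N : Type x} [Infinite V] (Γ : N → Program C F V) : ModExpr N F → Program C F V
  | name a => Γ a
  | union E₁ E₂ => flat Γ E₁ ∪ flat Γ E₂
  | delete E σ => (flat Γ E).delete σ
  | rename ρ E => (flat Γ E).map ρ
  | closure E => (flat Γ E).closure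

/-! ### Structured modules -/

/-- Labeled function symbols `L.f`. -/
abbrev LabSig (Ω : Type x) (F : ℕ → Type v) : ℕ → Type (max v x) := fun n => Ω × F n

/-- The signature made up of the visible and the labeled function symbols. -/
abbrev ExtSig (Ω : Type x) (F : ℕ → Type v) : ℕ → Type (max v x) := fun n => F n ⊕ (Ω × F n)

variable {Ω : Type x}

/-- The rule `f(X̄) → g(X̄)`, for pairwise distinct variables `X̄`. -/
noncomputable def forwardRule [Infinite V] {n : ℕ} (f g : F n) : Rule C F V f where
  args i := CTerm.var (Infinite.natEmbedding V i)
  rhs := Term.fn g fun i => Term.var (Infinite.natEmbedding V i)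
  cond := ∅
  args_total _ := trivial
  args_linear X := by
    by_cases h : ∃ i : Fin n, Infinite.natEmbedding V i = X
    · obtain ⟨i, rfl⟩ := h
      rw [Finset.sum_eq_single i]
      · simp [CTerm.occ]
      · intro j _ hj
        exact if_neg fun e => hj (Fin.ext ((Infinite.natEmbedding V).injective e))
      · simp
    · exact (Finset.sum_eq_zero fun i _ => if_neg fun e => h ⟨i, e⟩).trans_le zero_le_one
  rhs_ne_bot := by simp
  cond_finite := Set.finite_empty
  cond_total := by simp

/-- Bridge rules `source(X̄) → label.target(X̄)`. -/
structure Bridge (Ω : Type x) (F : ℕ → Type v) where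
  arity : ℕ
  source : F arity
  label : Ω
  target : F arity

/-- Structured modules `⟨σ_p, σ_e, R_V ∪ R_B ∪ R_H⟩`; the interface `(par, exp)` is determined by
the rules. -/
@[ext]
structure StructuredModule (Ω : Type x) (C : ℕ → Type u) (F : ℕ → Type v) (V : Type w) where
  visible : Program C F V
  bridge : Set (Bridge Ω F)
  hidden : Program C (LabSig Ω F) V
  bridge_defined : ∀ b ∈ bridge, (b.label, b.target) ∈ hidden.exp b.arity

namespace StructuredModule

/-- All the rules are finitely many. -/
def Finite (M : StructuredModule Ω C F V) : Prop :=
  M.visible.Finite ∧ M.bridge.Finite ∧ M.hidden.Finite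

/-- Exported signature: the visible symbols with a visible rule or a bridge rule. -/
def exp (M : StructuredModule Ω C F V) : SubSig F :=
  fun n => {f | f ∈ M.visible.exp n ∨ ∃ (L : Ω) (g : F n), ⟨n, f, L, g⟩ ∈ M.bridge}

/-- Parameter signature. -/
def par (M : StructuredModule Ω C F V) : SubSig F := fun n => M.visible.invoked n \ M.exp n

/-- A plain module as a structured module. -/
def ofPlain (P : Program C F V) : StructuredModule Ω C F V where
  visible := P
  bridge := ∅
  hidden := ∅
  bridge_defined := by simp

def union (M M' : StructuredModule Ω C F V) : StructuredModule Ω C F V where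
  visible := M.visible ∪ M'.visible
  bridge := M.bridge ∪ M'.bridge
  hidden := M.hidden ∪ M'.hidden
  bridge_defined := by
    rintro b (hb | hb)
    · obtain ⟨R, hR⟩ := M.bridge_defined b hb
      exact ⟨R, Or.inl hR⟩
    · obtain ⟨R, hR⟩ := M'.bridge_defined b hb
      exact ⟨R, Or.inr hR⟩

/-- Deletion of a visible signature. -/
def delete (M : StructuredModule Ω C F V) (σ : SubSig F) : StructuredModule Ω C F V where
  visible := M.visible.delete σ
  bridge := {b ∈ M.bridge | b.source ∉ σ b.arity}
  hidden := M.hidden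
  bridge_defined b hb := M.bridge_defined b hb.1

/-- Renaming of the visible function symbols. -/
def rename (ρ : Renaming F) (M : StructuredModule Ω C F V) : StructuredModule Ω C F V where
  visible := M.visible.map ρ
  bridge := (fun b => ⟨b.arity, ρ b.arity b.source, b.label, b.target⟩) '' M.bridge
  hidden := M.hidden
  bridge_defined := by
    rintro _ ⟨b, hb, rfl⟩
    exact M.bridge_defined b hb

/-- The body of the structured closure before adding new bridge rules: the visible symbols `f` of
visible rules and bridge rules become `L.f`, and labeled symbols are maintained. -/
def starHidden [Infinite V] (L : Ω) (M : StructuredModule Ω C F V) :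
    Program C (LabSig Ω F) V :=
  M.visible.map (fun _ f => (L, f)) ∪
    (fun b : Bridge Ω F => ⟨b.arity, (L, b.source),
      forwardRule (F := LabSig Ω F) (n := b.arity) (L, b.source) (b.label, b.target)⟩) '' M.bridge ∪
    M.hidden

/-- Structured closure of the module `M` with name `L`. -/
def star [Infinite V] (L : Ω) (M : StructuredModule Ω C F V) : StructuredModule Ω C F V where
  visible := ∅
  bridge := {b | b.source ∈ M.exp b.arity ∧ b.label = L ∧ b.target = b.source}
  hidden := M.starHidden L
  bridge_defined := by
    rintro ⟨n, f, l, g⟩ ⟨hf, hl, hg⟩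
    dsimp only at hf hl hg ⊢
    subst hl hg
    rcases hf with ⟨R, hR⟩ | ⟨L', g', hb⟩
    · exact ⟨R.map (F' := LabSig Ω F) fun _ f => (l, f), Or.inl (Or.inl ⟨_, hR, rfl⟩)⟩
    · exact ⟨_, Or.inl (Or.inr ⟨_, hb, rfl⟩)⟩

/-- The visible and bridge rules, over the extended signature. -/
def visibleExt [Infinite V] (M : StructuredModule Ω C F V) : Program C (ExtSig Ω F) V :=
  M.visible.map (fun _ => Sum.inl) ∪
    (fun b : Bridge Ω F => ⟨b.arity, Sum.inl b.source,
      forwardRule (F := ExtSig Ω F) (n := b.arity) (Sum.inl b.source)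
        (Sum.inr (b.label, b.target))⟩) '' M.bridge

/-- The hidden rules, over the extended signature. -/
def hiddenExt (M : StructuredModule Ω C F V) : Program C (ExtSig Ω F) V :=
  M.hidden.map fun _ => Sum.inr

end StructuredModule

/-- Extension of an algebra to the labeled symbols, with `L.f(t̄) = {⊥}`. -/
def TAlg.extend (Ω : Type x) (A : TAlg C F V) : TAlg C (ExtSig Ω F) V where
  interp f ts := Sum.elim (fun g => A.interp g ts) (fun _ => Set.Iic CTerm.bot) f
  nonempty f ts := by
    cases f
    · exact A.nonempty _ ts
    · exact Set.nonempty_Iic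
  isLowerSet f ts := by
    cases f
    · exact A.isLowerSet _ ts
    · exact isLowerSet_Iic _
  mono f := by
    cases f
    · exact A.mono _
    · exact monotone_const

/-- Reduct of an algebra to the visible symbols. -/
def TAlg.reduct (B : TAlg C (ExtSig Ω F) V) : TAlg C F V where
  interp f ts := B.interp (Sum.inl f) ts
  nonempty f ts := B.nonempty (Sum.inl f) ts
  isLowerSet f ts := B.isLowerSet (Sum.inl f) ts
  mono f := B.mono (Sum.inl f)

/-- The algebra transformer `U_M` of a structured module `M`. -/
def StructuredModule.U [Infinite V] (M : StructuredModule Ω C F V) (A : TAlg C F V) : TAlg C F V :=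
  (M.visibleExt.T (M.hiddenExt.Tω.sup (A.extend Ω))).reduct

/-- The representation morphism `ι` (the implementation of an expression). Labels are module
expressions; the closure of `E` uses the label `E`. -/
def ModExpr.impl {N : Type x} [Infinite V] (Γ : N → Program C F V) :
    ModExpr N F → StructuredModule (ModExpr N F) C F V
  | name a => .ofPlain (Γ a)
  | union E₁ E₂ => (impl Γ E₁).union (impl Γ E₂)
  | delete E σ => (impl Γ E).delete σ
  | rename ρ E => (impl Γ E).rename ρ
  | closure E => (impl Γ E).star E

end CRWL

/-! The transformer of a closure is constant: by `Program.T_closure` it sends every algebra to the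
least model T_P^ω. Derivability of f(t̄) → r is membership of r in that model at f(t̄)
(`Program.derives_fn_iff`), so every such fact with r ≠ ⊥ and f exported contributes a canonical
rule. The rule reproduces its fact (`crr_yields_self`) and adds nothing false (`crr_yields_sound`):
its conditions make the matching substitution total on the variables of the fact and equal on the
copies of a repeated variable, which is what consistency of T_P^ω needs. Right-hand sides and
conditions contain no function symbols, so the algebra plays no role.

An implementation therefore only has to make L.g mean g in the least model of the module denoted by
L. Under this reading, `ModExpr.mem_T_flat` shows by induction on E that T_E(A) consists of what the
visible rules yield in A together with the values delivered by bridges. `StructuredModule.mem_U`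
computes U in the same form, with L.g read in the least model of the hidden rules.

The two readings agree on the targets of bridges. The intended reading is closed under the hidden
rules, hence above their least model (`ModExpr.T_hidden_labelAlg_le`). Conversely, the least hidden
model seen through the label E is closed under T_E, hence above T_E^ω
(`ModExpr.Tω_flat_subset_hidden`). Consistency of U is then inherited from T_E. -/

namespace CRWL

variable {C : ℕ → Type u} {F : ℕ → Type v} {V : Type w}

/-! ### Substitutions and maximal constructor terms -/

namespace CTerm

theorem isMax_of_total {t : CTerm C V} (ht : t.Total) : IsMax t := by
  intro s hs
  have hs' : Approx t s := hs
  suffices s = t from this ▸ le_rfl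
  clear hs
  induction hs' with
  | bot => exact ht.elim
  | var X => rfl
  | con c ss ts h ih => exact congrArg _ (funext fun i => ih i (ht i))

theorem con_le_con {n : ℕ} (c : C n) {ss ts : Fin n → CTerm C V} (h : ∀ i, ss i ≤ ts i) :
    con c ss ≤ con c ts := Approx.con c ss ts h

/-- A variable lies strictly above ⊥, and a strict increase of one argument is a strict increase of
the whole term. -/
theorem total_of_isMax [Infinite V] {t : CTerm C V} (ht : IsMax t) : t.Total := by
  induction t with
  | bot =>
    have h : Approx (var (Infinite.natEmbedding V 0)) (bot : CTerm C V) := ht (bot_le' _)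
    cases h
  | var X => trivial
  | con c ts ih =>
    intro i
    refine ih i fun s hs => ?_
    have h : Approx (con c (Function.update ts i s)) (con c ts) := by
      refine ht (con_le_con c fun j => ?_)
      rcases eq_or_ne j i with rfl | hj
      · simpa using hs
      · simp [hj]
    cases h with
    | con _ _ _ h =>
      have := h i
      rwa [Function.update_self] at this

theorem subst_mono (θ : V → CTerm C V) {s t : CTerm C V} (h : s ≤ t) :
    s.subst θ ≤ t.subst θ := by
  have h' : Approx s t := h
  clear h
  induction h' with
  | bot t => exact bot_le' _
  | var X => exact le_rfl
  | con c ss ts h ih => exact con_le_con c ih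

theorem Total.subst {θ : V → CTerm C V} (hθ : ∀ X, (θ X).Total) {t : CTerm C V} (ht : t.Total) :
    (t.subst θ).Total := by
  induction t with
  | bot => exact ht.elim
  | var X => exact hθ X
  | con c ts ih => exact fun i => ih i (ht i)

theorem subst_subst (θ σ : V → CTerm C V) (t : CTerm C V) :
    (t.subst θ).subst σ = t.subst fun X => (θ X).subst σ := by
  induction t with
  | bot => rfl
  | var X => rfl
  | con c ts ih => exact congrArg _ (funext ih)

theorem subst_congr {θ σ : V → CTerm C V} {t : CTerm C V} (h : ∀ X ∈ t.vars, θ X = σ X) :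
    t.subst θ = t.subst σ := by
  induction t with
  | bot => rfl
  | var X => exact h X rfl
  | con c ts ih =>
    exact congrArg _ (funext fun i => ih i fun X hX => h X (Set.mem_iUnion.2 ⟨i, hX⟩))

theorem subst_var (t : CTerm C V) : t.subst var = t := by
  induction t with
  | bot => rfl
  | var X => rfl
  | con c ts ih => exact congrArg _ (funext ih)

end CTerm

namespace Term

theorem ofCTerm_subst (θ : V → CTerm C V) (t : CTerm C V) :
    (ofCTerm t : Term C F V).subst θ = ofCTerm (t.subst θ) := by
  induction t with
  | bot => rfl
  | var X => rfl
  | con c ts ih => exact congrArg _ (funext ih)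

theorem subst_subst (θ σ : V → CTerm C V) (e : Term C F V) :
    (e.subst θ).subst σ = e.subst fun X => (θ X).subst σ := by
  induction e with
  | bot => rfl
  | var X => exact ofCTerm_subst σ (θ X)
  | con c es ih => exact congrArg _ (funext ih)
  | fn f es ih => exact congrArg _ (funext ih)

theorem map_ofCTerm {F' : ℕ → Type x} (φ : ∀ n, F n → F' n) (t : CTerm C V) :
    (ofCTerm t : Term C F V).map φ = ofCTerm t := by
  induction t with
  | bot => rfl
  | var X => rfl
  | con c ts ih => exact congrArg _ (funext ih)

theorem map_subst {F' : ℕ → Type x} (φ : ∀ n, F n → F' n) (θ : V → CTerm C V) (e : Term C F V) :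
    (e.map φ).subst θ = (e.subst θ).map φ := by
  induction e with
  | bot => rfl
  | var X => exact (map_ofCTerm φ (θ X)).symm
  | con c es ih => exact congrArg _ (funext ih)
  | fn f es ih => exact congrArg _ (funext ih)

end Term

/-! ### The order of term algebras -/

namespace TAlg

instance : PartialOrder (TAlg C F V) where
  le A B := ∀ (n : ℕ) (f : F n) (ts : Fin n → CTerm C V), A.interp f ts ⊆ B.interp f ts
  le_refl _ _ _ _ := subset_rfl
  le_trans _ _ _ h₁ h₂ n f ts := (h₁ n f ts).trans (h₂ n f ts)
  le_antisymm A B h₁ h₂ := by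
    ext n f ts : 4
    exact (h₁ n f ts).antisymm (h₂ n f ts)

theorem bot_mem_interp (A : TAlg C F V) {n : ℕ} (f : F n) (ts : Fin n → CTerm C V) :
    CTerm.bot ∈ A.interp f ts :=
  (A.nonempty f ts).elim fun u hu => A.isLowerSet f ts (CTerm.bot_le' u) hu

theorem bot_le' (A : TAlg C F V) : TAlg.bot ≤ A := fun _ f ts u hu => by
  rw [le_antisymm hu (CTerm.bot_le' u)]
  exact A.bot_mem_interp f ts

theorem bot_mem_eval (A : TAlg C F V) (η : V → CTerm C V) (e : Term C F V) :
    CTerm.bot ∈ A.eval η e := by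
  induction e with
  | bot => exact CTerm.bot_le' _
  | var X => exact CTerm.bot_le' _
  | con c es ih => exact ⟨fun _ => CTerm.bot, ih, CTerm.bot_le' _⟩
  | fn f es ih => exact ⟨fun _ => CTerm.bot, ih, A.bot_mem_interp f _⟩

theorem eval_mono {A B : TAlg C F V} (h : A ≤ B) (η : V → CTerm C V) (e : Term C F V) :
    A.eval η e ⊆ B.eval η e := by
  induction e with
  | bot => exact subset_rfl
  | var X => exact subset_rfl
  | con c es ih =>
    rintro u ⟨ts, hts, hu⟩
    exact ⟨ts, fun i => ih i (hts i), hu⟩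
  | fn f es ih =>
    rintro u ⟨ts, hts, hu⟩
    exact ⟨ts, fun i => ih i (hts i), h _ f ts hu⟩

theorem Joinable.mono {A B : TAlg C F V} (h : A ≤ B) {η : V → CTerm C V} {a b : Term C F V} :
    A.Joinable η a b → B.Joinable η a b
  | ⟨t, ⟨ha, hb⟩, ht⟩ => ⟨t, ⟨eval_mono h η a ha, eval_mono h η b hb⟩, ht⟩

theorem eval_ofCTerm (A : TAlg C F V) (t : CTerm C V) :
    A.eval CTerm.var (Term.ofCTerm t) = Set.Iic t := by
  induction t with
  | bot => rfl
  | var X => rfl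
  | con c ts ih =>
    ext u
    constructor
    · rintro ⟨ss, hss, hu⟩
      refine le_trans (Set.mem_Iic.1 hu) (CTerm.con_le_con c fun i => ?_)
      simpa [ih i] using hss i
    · intro hu
      exact ⟨ts, fun i => by simp [ih i], hu⟩

/-- A constructor term evaluates to its principal ideal, whose only possible maximal element is the
term itself. The conditions of canonical rules thus mean the same in every algebra. -/
theorem joinable_ofCTerm [Infinite V] (A : TAlg C F V) (s t : CTerm C V) :
    A.Joinable CTerm.var (Term.ofCTerm s) (Term.ofCTerm t) ↔ s.Total ∧ s = t := by
  constructor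
  · rintro ⟨u, ⟨hs, ht⟩, hu⟩
    rw [eval_ofCTerm] at hs ht
    obtain rfl := hu.eq_of_le hs
    exact ⟨CTerm.total_of_isMax hu, hu.eq_of_le ht⟩
  · rintro ⟨hs, rfl⟩
    refine ⟨s, ⟨?_, ?_⟩, CTerm.isMax_of_total hs⟩ <;> simp [eval_ofCTerm]

theorem exists_bound {ι : Type*} [Finite ι] {p : ι → ℕ → Prop}
    (hp : ∀ i k l, k ≤ l → p i k → p i l) (h : ∀ i, ∃ k, p i k) : ∃ k, ∀ i, p i k := by
  choose k hk using h
  obtain ⟨m, hm⟩ := (Set.finite_range k).bddAbove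
  exact ⟨m, fun i => hp i _ _ (hm ⟨i, rfl⟩) (hk i)⟩

/-- Evaluation is continuous: arities are finite, so a value depends on finitely many function
values, all present at a common stage of the chain. -/
theorem exists_mem_eval_of_seqSup {A : ℕ → TAlg C F V} (hA : Monotone A) (η : V → CTerm C V)
    {e : Term C F V} {u : CTerm C V} (hu : u ∈ (seqSup A).eval η e) : ∃ k, u ∈ (A k).eval η e := by
  induction e generalizing u with
  | bot => exact ⟨0, hu⟩
  | var X => exact ⟨0, hu⟩
  | con c es ih =>
    obtain ⟨ts, hts, hu⟩ := hu
    obtain ⟨k, hk⟩ := exists_bound (p := fun i k => ts i ∈ (A k).eval η (es i))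
      (fun i k l hkl h => eval_mono (hA hkl) η _ h) fun i => ih i (hts i)
    exact ⟨k, ts, hk, hu⟩
  | fn f es ih =>
    obtain ⟨ts, hts, hu⟩ := hu
    obtain ⟨k, hk⟩ := exists_bound (p := fun i k => ts i ∈ (A k).eval η (es i))
      (fun i k l hkl h => eval_mono (hA hkl) η _ h) fun i => ih i (hts i)
    obtain ⟨l, hl⟩ := Set.mem_iUnion.1 hu
    exact ⟨max k l, ts, fun i => eval_mono (hA (le_max_left k l)) η _ (hk i),
      hA (le_max_right k l) _ f ts hl⟩

theorem exists_joinable_of_seqSup {A : ℕ → TAlg C F V} (hA : Monotone A) {η : V → CTerm C V}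
    {a b : Term C F V} (h : (seqSup A).Joinable η a b) : ∃ k, (A k).Joinable η a b := by
  obtain ⟨t, ⟨ha, hb⟩, ht⟩ := h
  obtain ⟨k, hk⟩ := exists_mem_eval_of_seqSup hA η ha
  obtain ⟨l, hl⟩ := exists_mem_eval_of_seqSup hA η hb
  exact ⟨max k l, t, ⟨eval_mono (hA (le_max_left k l)) η _ hk,
    eval_mono (hA (le_max_right k l)) η _ hl⟩, ht⟩

end TAlg

/-! ### The transformer of a program and its least fixpoint -/

/-- The rule produces the value `u` at the arguments `ts`, in the algebra `A`. -/
def Rule.Yields {n : ℕ} {f : F n} (R : Rule C F V f) (A : TAlg C F V) (ts : Fin n → CTerm C V)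
    (u : CTerm C V) : Prop :=
  ∃ θ : V → CTerm C V, (∀ i, (R.args i).subst θ ≤ ts i) ∧
    (∀ p ∈ R.cond, A.Joinable CTerm.var (p.1.subst θ) (p.2.subst θ)) ∧
    u ∈ A.eval CTerm.var (R.rhs.subst θ)

theorem Rule.Yields.mono {n : ℕ} {f : F n} {R : Rule C F V f} {A B : TAlg C F V} (h : A ≤ B)
    {ts : Fin n → CTerm C V} {u : CTerm C V} : R.Yields A ts u → R.Yields B ts u
  | ⟨θ, hargs, hcond, hu⟩ =>
    ⟨θ, hargs, fun p hp => (hcond p hp).mono h, TAlg.eval_mono h _ _ hu⟩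

namespace Program

theorem mem_T {P : Program C F V} {A : TAlg C F V} {n : ℕ} {f : F n} {ts : Fin n → CTerm C V}
    {u : CTerm C V} : u ∈ (P.T A).interp f ts ↔
      (∃ R : Rule C F V f, ⟨n, f, R⟩ ∈ P ∧ R.Yields A ts u) ∨ u = CTerm.bot := by
  constructor
  · rintro (⟨R, θ, hR, h⟩ | h)
    · exact Or.inl ⟨R, hR, θ, h⟩
    · exact Or.inr h
  · rintro (⟨R, hR, θ, h⟩ | h)
    · exact Or.inl ⟨R, θ, hR, h⟩
    · exact Or.inr h

theorem T_mono (P : Program C F V) : Monotone P.T := fun _ _ h _ _ _ _ hu =>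
  mem_T.2 <| (mem_T.1 hu).imp_left fun ⟨R, hR, hy⟩ => ⟨R, hR, hy.mono h⟩

theorem iterate_T_mono (P : Program C F V) : Monotone fun k => P.T^[k] TAlg.bot :=
  P.T_mono.monotone_iterate_of_le_map (TAlg.bot_le' _)

/-- A rule application tests finitely many conditions and one value of the right-hand side. All hold
at some finite stage, and the result appears one stage later. -/
theorem T_Tω_le (P : Program C F V) : P.T P.Tω ≤ P.Tω := by
  intro n f ts u hu
  rcases mem_T.1 hu with ⟨R, hR, θ, hargs, hcond, hu⟩ | rfl
  · have := R.cond_finite.to_subtype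
    obtain ⟨k, hk⟩ := TAlg.exists_bound
      (p := fun (p : R.cond) k => (P.T^[k] TAlg.bot).Joinable CTerm.var (p.1.1.subst θ)
        (p.1.2.subst θ))
      (fun p k l hkl => TAlg.Joinable.mono (P.iterate_T_mono hkl))
      fun p => TAlg.exists_joinable_of_seqSup P.iterate_T_mono (hcond p p.2)
    obtain ⟨l, hl⟩ := TAlg.exists_mem_eval_of_seqSup P.iterate_T_mono _ hu
    refine Set.mem_iUnion.2 ⟨max k l + 1, ?_⟩
    dsimp only
    rw [Function.iterate_succ_apply']
    exact mem_T.2 (Or.inl ⟨R, hR, θ, hargs,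
      fun p hp => (hk ⟨p, hp⟩).mono (P.iterate_T_mono (le_max_left k l)),
      TAlg.eval_mono (P.iterate_T_mono (le_max_right k l)) _ _ hl⟩)
  · exact TAlg.bot_mem_interp _ f ts

theorem Tω_le {P : Program C F V} {A : TAlg C F V} (h : P.T A ≤ A) : P.Tω ≤ A := by
  have hk : ∀ k, P.T^[k] TAlg.bot ≤ A := fun k => by
    induction k with
    | zero => exact A.bot_le'
    | succ k ih =>
      rw [Function.iterate_succ_apply']
      exact (P.T_mono ih).trans h
  intro n f ts u hu
  obtain ⟨k, hu⟩ := Set.mem_iUnion.1 hu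
  exact hk k n f ts hu

/-- T_P(T_P^ω) is itself closed under T_P, so leastness gives the missing inclusion. -/
theorem T_Tω (P : Program C F V) : P.T P.Tω = P.Tω :=
  P.T_Tω_le.antisymm (Tω_le (P.T_mono P.T_Tω_le))

end Program

/-! ### Consistency -/

namespace TAlg

theorem Consistent.subst_mem_eval {A : TAlg C F V} (hA : A.Consistent) {θ : V → CTerm C V}
    (hθ : ∀ X, (θ X).Total) {e : Term C F V} {u : CTerm C V} (hu : u ∈ A.eval CTerm.var e) :
    u.subst θ ∈ A.eval CTerm.var (e.subst θ) := by
  induction e generalizing u with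
  | bot => exact CTerm.subst_mono θ hu
  | var X =>
    have h := CTerm.subst_mono θ (Set.mem_Iic.1 hu)
    change _ ∈ A.eval CTerm.var (Term.ofCTerm (θ X))
    rwa [eval_ofCTerm]
  | con c es ih =>
    obtain ⟨ts, hts, hu⟩ := hu
    exact ⟨fun i => (ts i).subst θ, fun i => ih i (hts i), CTerm.subst_mono θ hu⟩
  | fn f es ih =>
    obtain ⟨ts, hts, hu⟩ := hu
    exact ⟨fun i => (ts i).subst θ, fun i => ih i (hts i), hA f ts θ hθ ⟨u, hu, rfl⟩⟩

/-- Totality of θ is essential here: the common value must stay maximal after substitution. -/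
theorem Consistent.subst_joinable [Infinite V] {A : TAlg C F V} (hA : A.Consistent)
    {θ : V → CTerm C V} (hθ : ∀ X, (θ X).Total) {a b : Term C F V}
    (h : A.Joinable CTerm.var a b) : A.Joinable CTerm.var (a.subst θ) (b.subst θ) := by
  obtain ⟨t, ⟨ha, hb⟩, ht⟩ := h
  exact ⟨t.subst θ, ⟨hA.subst_mem_eval hθ ha, hA.subst_mem_eval hθ hb⟩,
    CTerm.isMax_of_total ((CTerm.total_of_isMax ht).subst hθ)⟩

theorem bot_consistent : (TAlg.bot : TAlg C F V).Consistent := by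
  rintro n f ts θ hθ _ ⟨u, hu, rfl⟩
  exact CTerm.subst_mono θ hu

end TAlg

namespace Program

/-- The matching substitution of the rule is composed with the given one. -/
theorem T_consistent [Infinite V] (P : Program C F V) {A : TAlg C F V} (hA : A.Consistent) :
    (P.T A).Consistent := by
  rintro n f ts σ hσ _ ⟨u, hu, rfl⟩
  rcases mem_T.1 hu with ⟨R, hR, θ, hargs, hcond, hu⟩ | rfl
  · refine mem_T.2 (Or.inl ⟨R, hR, fun X => (θ X).subst σ, fun i => ?_, fun p hp => ?_, ?_⟩)
    · rw [← CTerm.subst_subst]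
      exact CTerm.subst_mono σ (hargs i)
    · rw [← Term.subst_subst, ← Term.subst_subst]
      exact hA.subst_joinable hσ (hcond p hp)
    · rw [← Term.subst_subst]
      exact hA.subst_mem_eval hσ hu
  · exact mem_T.2 (Or.inr rfl)

theorem Tω_consistent [Infinite V] (P : Program C F V) : P.Tω.Consistent := by
  have hk : ∀ k, (P.T^[k] TAlg.bot).Consistent := fun k => by
    induction k with
    | zero => exact TAlg.bot_consistent
    | succ k ih =>
      rw [Function.iterate_succ_apply']
      exact P.T_consistent ih
  rintro n f ts θ hθ _ ⟨u, hu, rfl⟩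
  obtain ⟨k, hu⟩ := Set.mem_iUnion.1 hu
  exact Set.mem_iUnion.2 ⟨k, hk k f ts θ hθ ⟨u, hu, rfl⟩⟩

end Program

/-! ### Derivations and the least fixpoint -/

/-- Truth of a formula in an algebra, under the identity valuation. -/
def Formula.Holds (A : TAlg C F V) : Formula C F V → Prop
  | .red e t => t ∈ A.eval CTerm.var e
  | .join a b => A.Joinable CTerm.var a b

theorem Derives.holds {P : Program C F V} {φ : Formula C F V} (h : Derives P φ) :
    φ.Holds P.Tω := by
  induction h with
  | Bo e => exact P.Tω.bot_mem_eval _ e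
  | RR X => exact Set.mem_Iic.2 le_rfl
  | DS c es ts h ih => exact ⟨ts, ih, Set.mem_Iic.2 le_rfl⟩
  | OR f es t R hR θ hargs hcond hrhs ht ihargs ihcond ihrhs =>
    exact ⟨_, ihargs, P.T_Tω_le _ _ _
      (Program.mem_T.2 (Or.inl ⟨R, hR, θ, fun _ => le_rfl, ihcond, ihrhs⟩))⟩
  | Jo a b t ht ha hb iha ihb => exact ⟨t, ⟨iha, ihb⟩, CTerm.isMax_of_total ht⟩

theorem derives_ofCTerm (P : Program C F V) {s t : CTerm C V} (h : t ≤ s) :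
    Derives P (.red (Term.ofCTerm s) t) := by
  have h' : CTerm.Approx t s := h
  clear h
  induction h' with
  | bot s => exact .Bo _
  | var X => exact .RR X
  | con c ss ts h ih => exact .DS c _ _ ih

theorem Derives.of_le {P : Program C F V} {e : Term C F V} {s t : CTerm C V}
    (h : Derives P (.red e t)) (hst : s ≤ t) : Derives P (.red e s) := by
  generalize hφ : Formula.red e t = φ at h
  induction h generalizing e s t with
  | Bo e' =>
    cases hφ
    rw [le_antisymm hst (CTerm.bot_le' s)]
    exact .Bo _
  | RR X =>
    cases hφ
    exact derives_ofCTerm P (s := CTerm.var X) hst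
  | DS c es ts h ih =>
    cases hφ
    cases (show CTerm.Approx s _ from hst) with
    | bot => exact .Bo _
    | con _ ss _ h => exact .DS c es ss fun i => ih i (h i) rfl
  | OR f es t' R hR θ hargs hcond hrhs ht ihargs ihcond ihrhs =>
    cases hφ
    by_cases hs : s = CTerm.bot
    · subst hs
      exact .Bo _
    · exact .OR f es s R hR θ hargs hcond (ihrhs hst rfl) hs
  | Jo a b t ht ha hb iha ihb => cases hφ

/-- Read off from soundness in the least model, without analysing the derivation. -/
theorem Derives.le_of_ofCTerm {P : Program C F V} {s t : CTerm C V}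
    (h : Derives P (.red (Term.ofCTerm s) t)) : t ≤ s := by
  have := h.holds
  rwa [Formula.Holds, TAlg.eval_ofCTerm] at this

/-- A form of cut. The last step matches the rule arguments below the values `ts`, and whatever lies
below a derivable value is derivable. -/
theorem Derives.fn_mono {P : Program C F V} {n : ℕ} {f : F n} {es : Fin n → Term C F V}
    {ts : Fin n → CTerm C V} {u : CTerm C V} (hes : ∀ i, Derives P (.red (es i) (ts i)))
    (h : Derives P (.red (Term.fn f fun i => Term.ofCTerm (ts i)) u)) :
    Derives P (.red (Term.fn f es) u) := by
  cases h with
  | Bo => exact .Bo _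
  | OR _ _ _ R hR θ hargs hcond hrhs ht =>
    exact .OR f es u R hR θ (fun i => (hes i).of_le (hargs i).le_of_ofCTerm) hcond hrhs ht

/-- The algebra of the derivable reductions. -/
def Program.derivAlg (P : Program C F V) : TAlg C F V where
  interp f ts := {u | Derives P (.red (Term.fn f fun i => Term.ofCTerm (ts i)) u)}
  nonempty _ _ := ⟨CTerm.bot, .Bo _⟩
  isLowerSet _ _ _ _ hst h := Derives.of_le h hst
  mono _ _ _ h _ hu := Derives.fn_mono (fun i => derives_ofCTerm P (h i)) hu

theorem Program.derives_of_mem_eval {P : Program C F V} {e : Term C F V} {u : CTerm C V}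
    (hu : u ∈ P.derivAlg.eval CTerm.var e) : Derives P (.red e u) := by
  induction e generalizing u with
  | bot =>
    rw [le_antisymm hu (CTerm.bot_le' u)]
    exact .Bo _
  | var X => exact derives_ofCTerm P (s := CTerm.var X) hu
  | con c es ih =>
    obtain ⟨ts, hts, hu⟩ := hu
    exact (Derives.DS c es ts fun i => ih i (hts i)).of_le hu
  | fn f es ih =>
    obtain ⟨ts, hts, hu⟩ := hu
    exact Derives.fn_mono (fun i => ih i (hts i)) hu

theorem Program.T_derivAlg_le [Infinite V] (P : Program C F V) :
    P.T P.derivAlg ≤ P.derivAlg := by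
  intro n f ts u hu
  by_cases hb : u = CTerm.bot
  · exact hb ▸ .Bo _
  · obtain ⟨R, hR, θ, hargs, hcond, hu⟩ := (mem_T.1 hu).resolve_right hb
    refine .OR f _ u R hR θ (fun i => derives_ofCTerm P (hargs i)) (fun p hp => ?_)
      (derives_of_mem_eval hu) hb
    obtain ⟨t, ⟨h₁, h₂⟩, ht⟩ := hcond p hp
    exact .Jo _ _ t (CTerm.total_of_isMax ht) (derives_of_mem_eval h₁) (derives_of_mem_eval h₂)

/-- Soundness is `Derives.holds` with monotonicity. For completeness, the algebra of derivable
reductions is closed under the rules, so it contains the least model. -/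
theorem Program.derives_fn_iff [Infinite V] {P : Program C F V} {n : ℕ} {f : F n}
    {ts : Fin n → CTerm C V} {u : CTerm C V} :
    Derives P (.red (Term.fn f fun i => Term.ofCTerm (ts i)) u) ↔ u ∈ P.Tω.interp f ts := by
  constructor
  · intro h
    obtain ⟨ss, hss, hu⟩ := h.holds
    refine P.Tω.mono f (fun i => ?_) hu
    have := hss i
    rwa [TAlg.eval_ofCTerm] at this
  · exact fun h => Program.Tω_le P.T_derivAlg_le n f ts h

/-! ### Canonical rewrite rules -/

/-- The subterm at a position, which is `⊥` for positions outside the term. -/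
def CTerm.subtermAt : CTerm C V → List ℕ → CTerm C V
  | t, [] => t
  | @CTerm.con _ _ n _ ts, i :: p => if h : i < n then subtermAt (ts ⟨i, h⟩) p else CTerm.bot
  | _, _ :: _ => CTerm.bot

theorem subst_linearize {fr : List ℕ → V} {rep : V → Prop} {θ : V → CTerm C V} (t : CTerm C V)
    (p : List ℕ) (hvars : ∀ X ∈ t.vars, θ X = CTerm.var X)
    (hfr : ∀ q, θ (fr (p ++ q)) = t.subtermAt q) : (linearize fr rep t p).subst θ = t := by
  induction t generalizing p with
  | bot => simpa [CTerm.subtermAt, linearize, CTerm.subst] using hfr []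
  | var X =>
    unfold linearize
    split_ifs
    · simpa [CTerm.subtermAt, CTerm.subst] using hfr []
    · exact hvars X rfl
  | con c ts ih =>
    refine congrArg _ (funext fun i => ih i _ (fun X hX => hvars X (Set.mem_iUnion.2 ⟨i, hX⟩))
      fun q => ?_)
    have := hfr (i :: q)
    simpa [CTerm.subtermAt] using this

theorem subst_links {fr : List ℕ → V} {rep : V → Prop} {θ : V → CTerm C V} (t : CTerm C V)
    (p : List ℕ) (hvars : ∀ X ∈ t.vars, θ X = CTerm.var X)
    (hfr : ∀ q, θ (fr (p ++ q)) = t.subtermAt q) {l : Term C F V × Term C F V}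
    (hl : l ∈ links fr rep t p) : ∃ X, l.1.subst θ = Term.var X ∧ l.2.subst θ = Term.var X := by
  induction t generalizing p with
  | bot => exact hl.elim
  | var X =>
    obtain ⟨-, rfl⟩ := hl
    have := hfr []
    rw [List.append_nil] at this
    exact ⟨X, congrArg Term.ofCTerm (hvars X rfl), congrArg Term.ofCTerm this⟩
  | con c ts ih =>
    obtain ⟨i, hi⟩ := Set.mem_iUnion.1 hl
    refine ih i _ (fun X hX => hvars X (Set.mem_iUnion.2 ⟨i, hX⟩)) (fun q => ?_) hi
    have := hfr (i :: q)
    simpa [CTerm.subtermAt] using this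

theorem exists_mem_links {fr : List ℕ → V} {rep : V → Prop} {X : V} (hX : rep X) (t : CTerm C V)
    (p : List ℕ) (h : X ∈ t.vars) :
    ∃ q, ((Term.var X, Term.var (fr q)) : Term C F V × Term C F V) ∈ links fr rep t p := by
  induction t generalizing p with
  | bot => exact h.elim
  | var Y =>
    obtain rfl : X = Y := h
    exact ⟨p, hX, rfl⟩
  | con c ts ih =>
    obtain ⟨i, hi⟩ := Set.mem_iUnion.1 h
    obtain ⟨q, hq⟩ := ih i (p ++ [(i : ℕ)]) hi
    exact ⟨q, Set.mem_iUnion.2 ⟨i, hq⟩⟩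

/-- Only an inequality: the variable that replaces an occurrence of ⊥ may take any value. -/
theorem subst_le_subst_linearize {fr : List ℕ → V} {rep : V → Prop} {θ : V → CTerm C V}
    (t : CTerm C V) (p : List ℕ)
    (h : ∀ X q, ((Term.var X, Term.var (fr q)) : Term C F V × Term C F V) ∈ links fr rep t p →
      θ X = θ (fr q)) :
    t.subst θ ≤ (linearize fr rep t p).subst θ := by
  induction t generalizing p with
  | bot => exact CTerm.bot_le' _
  | var X =>
    unfold linearize
    split_ifs with hX
    · exact (h X p ⟨hX, rfl⟩).le
    · exact le_rfl
  | con c ts ih =>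
    exact CTerm.con_le_con c fun i => ih i _ fun X q hq => h X q (Set.mem_iUnion.2 ⟨i, hq⟩)

theorem crr_yields_self [Infinite V] (A : TAlg C F V) {n : ℕ} (f : F n) (ts : Fin n → CTerm C V)
    (r : CTerm C V) (hr : r ≠ CTerm.bot) : (crr f ts r hr).Yields A ts r := by
  classical
  set fr := fresh (allVars_finite ts r)
  -- A position is an argument index followed by a path in that argument. The values at the empty
  -- list and at indices out of range are never used.
  let sub : List ℕ → CTerm C V := fun
    | [] => CTerm.bot
    | i :: p => if h : i < n then (ts ⟨i, h⟩).subtermAt p else CTerm.bot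
  -- Original variables are fixed, and each fresh variable gets the subterm it replaced. The
  -- linearized arguments become `ts` again, and links become X ⋈ X.
  let θ : V → CTerm C V := fun X =>
    if X ∈ allVars ts r then CTerm.var X else Function.extend fr sub CTerm.var X
  have hvars : ∀ X ∈ allVars ts r, θ X = CTerm.var X := fun X hX => if_pos hX
  have hts : ∀ i, ∀ X ∈ (ts i).vars, θ X = CTerm.var X := fun i X hX =>
    hvars X (Or.inl (Set.mem_iUnion.2 ⟨i, hX⟩))
  have hpos : ∀ (i : Fin n) q, θ (fr ([(i : ℕ)] ++ q)) = (ts i).subtermAt q := fun i q => by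
    have h := fresh_notMem (allVars_finite ts r) ([(i : ℕ)] ++ q)
    rw [show θ (fr ([(i : ℕ)] ++ q)) = Function.extend fr sub CTerm.var _ from if_neg h,
      (fresh_injective (allVars_finite ts r)).extend_apply]
    simp [sub]
  refine ⟨θ, fun i => (subst_linearize (ts i) _ (hts i) (hpos i)).le, ?_, ?_⟩
  · rintro l (hl | ⟨X, ⟨hX, -⟩, rfl⟩)
    · obtain ⟨i, hi⟩ := Set.mem_iUnion.1 hl
      obtain ⟨X, h₁, h₂⟩ := subst_links (ts i) _ (hts i) (hpos i) hi
      rw [h₁, h₂]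
      exact (A.joinable_ofCTerm (CTerm.var X) (CTerm.var X)).2 ⟨trivial, rfl⟩
    · refine (A.joinable_ofCTerm (θ X) (θ X)).2 ⟨?_, rfl⟩
      rw [hvars X hX]
      trivial
  · change r ∈ A.eval CTerm.var ((Term.ofCTerm r).subst θ)
    rw [Term.ofCTerm_subst, TAlg.eval_ofCTerm,
      CTerm.subst_congr fun X hX => hvars X (Or.inr hX), CTerm.subst_var]
    exact Set.mem_Iic.2 le_rfl

/-- The fact r ∈ f(s̄) is instantiated by consistency of `B`, then weakened: the instantiated
arguments lie below `ts` because the links identify copies, and `u` lies below the instance of r. -/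
theorem crr_yields_sound [Infinite V] {A B : TAlg C F V} (hB : B.Consistent) {n : ℕ} {f : F n}
    {ss ts : Fin n → CTerm C V} {r u : CTerm C V} {hr : r ≠ CTerm.bot} (h : r ∈ B.interp f ss)
    (hu : (crr f ss r hr).Yields A ts u) : u ∈ B.interp f ts := by
  classical
  obtain ⟨θ, hargs, hcond, hu⟩ := hu
  have hlink : ∀ i X q, ((Term.var X, Term.var (fresh (allVars_finite ss r) q)) :
      Term C F V × Term C F V) ∈ links (fresh (allVars_finite ss r)) (Repeated ss) (ss i)
        [(i : ℕ)] → (θ X).Total ∧ θ X = θ (fresh (allVars_finite ss r) q) := fun i X q hq =>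
    (A.joinable_ofCTerm _ _).1 (hcond _ (Or.inl (Set.mem_iUnion.2 ⟨i, hq⟩)))
  -- A variable without a condition X ⋈ X is repeated and absent from r, so it occurs in `ss` and a
  -- link forces its value to be total.
  have htot : ∀ X ∈ allVars ss r, (θ X).Total := fun X hX => by
    by_cases h : X ∈ r.vars ∨ ¬ Repeated ss X
    · exact ((A.joinable_ofCTerm _ _).1 (hcond _ (Or.inr ⟨X, ⟨hX, h⟩, rfl⟩))).1
    · push Not at h
      obtain ⟨i, hi⟩ := Set.mem_iUnion.1 (hX.resolve_right h.1)
      obtain ⟨q, hq⟩ := exists_mem_links (F := F) (fr := fresh (allVars_finite ss r)) h.2 (ss i)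
        [(i : ℕ)] hi
      exact (hlink i X q hq).1
  -- The match may be partial elsewhere, for instance on variables replacing ⊥, whereas consistency
  -- needs a substitution total everywhere.
  let σ : V → CTerm C V := fun X => if X ∈ allVars ss r then θ X else CTerm.var X
  have hσ : ∀ X ∈ allVars ss r, σ X = θ X := fun X hX => if_pos hX
  have hσt : ∀ X, (σ X).Total := fun X => by
    by_cases hX : X ∈ allVars ss r
    · rw [hσ X hX]
      exact htot X hX
    · rw [show σ X = CTerm.var X from if_neg hX]
      trivial
  have hmem := hB f ss σ hσt ⟨r, h, rfl⟩
  change u ∈ A.eval CTerm.var ((Term.ofCTerm r).subst θ) at hu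
  rw [Term.ofCTerm_subst, TAlg.eval_ofCTerm,
    ← CTerm.subst_congr fun X hX => hσ X (Or.inr hX)] at hu
  refine B.isLowerSet f ts hu (B.mono f (fun i => ?_) hmem)
  change (ss i).subst σ ≤ ts i
  rw [CTerm.subst_congr fun X hX => hσ X (Or.inl (Set.mem_iUnion.2 ⟨i, hX⟩))]
  exact (subst_le_subst_linearize (F := F) (ss i) [(i : ℕ)]
    fun X q hq => (hlink i X q hq).2).trans (hargs i)

theorem Program.eq_bot_of_notMem_exp {P : Program C F V} {A : TAlg C F V} {n : ℕ} {f : F n}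
    (hf : f ∉ P.exp n) {ts : Fin n → CTerm C V} {u : CTerm C V} (hu : u ∈ (P.T A).interp f ts) :
    u = CTerm.bot :=
  (mem_T.1 hu).resolve_left fun ⟨R, hR, _⟩ => hf ⟨R, hR⟩

/-- Nonexported symbols take only the value ⊥ in the least model, so restricting the closure to
exported symbols loses nothing. -/
theorem Program.T_closure [Infinite V] (P : Program C F V) (A : TAlg C F V) :
    P.closure.T A = P.Tω := by
  apply le_antisymm
  · intro n f ts u hu
    rcases mem_T.1 hu with ⟨R, ⟨m, g, ss, r, hr, -, hd, h⟩, hy⟩ | rfl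
    · cases h
      exact crr_yields_sound P.Tω_consistent (derives_fn_iff.1 hd) hy
    · exact P.Tω.bot_mem_interp f ts
  · intro n f ts u hu
    by_cases hb : u = CTerm.bot
    · exact mem_T.2 (Or.inr hb)
    · have hf : f ∈ P.exp n := by
        by_contra hf
        rw [← T_Tω] at hu
        exact hb (eq_bot_of_notMem_exp hf hu)
      exact mem_T.2 (Or.inl ⟨crr f ts u hb, ⟨n, f, ts, u, hb, hf, derives_fn_iff.2 hu, rfl⟩,
        crr_yields_self A f ts u hb⟩)

/-! ### Operations on programs -/

/-- The algebra over the source signature of a mapping of function symbols. -/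
def TAlg.comap {F' : ℕ → Type x} (φ : ∀ n, F n → F' n) (A : TAlg C F' V) : TAlg C F V where
  interp f ts := A.interp (φ _ f) ts
  nonempty f := A.nonempty (φ _ f)
  isLowerSet f := A.isLowerSet (φ _ f)
  mono f := A.mono (φ _ f)

theorem TAlg.eval_map {F' : ℕ → Type x} (φ : ∀ n, F n → F' n) (A : TAlg C F' V)
    (η : V → CTerm C V) (e : Term C F V) : A.eval η (e.map φ) = (A.comap φ).eval η e := by
  induction e with
  | bot => rfl
  | var X => rfl
  | con c es ih => simp only [Term.map, TAlg.eval, ih]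
  | fn f es ih => simp only [Term.map, TAlg.eval, ih, TAlg.comap]

theorem Rule.yields_map {F' : ℕ → Type x} {φ : ∀ n, F n → F' n} {n : ℕ} {f : F n}
    {R : Rule C F V f} {A : TAlg C F' V} {ts : Fin n → CTerm C V} {u : CTerm C V} :
    (R.map φ).Yields A ts u ↔ R.Yields (A.comap φ) ts u := by
  simp only [Rule.Yields, Rule.map, TAlg.Joinable, Set.forall_mem_image, Term.map_subst,
    TAlg.eval_map]

theorem Rule.yields_forwardRule [Infinite V] {n : ℕ} {f g : F n} {A : TAlg C F V}
    {ts : Fin n → CTerm C V} {u : CTerm C V} :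
    (forwardRule f g).Yields A ts u ↔ u ∈ A.interp g ts := by
  constructor
  · rintro ⟨θ, hargs, -, ss, hss, hu⟩
    refine A.mono g (fun i => le_trans ?_ (hargs i)) hu
    have := hss i
    change ss i ∈ A.eval CTerm.var (Term.ofCTerm _) at this
    rwa [TAlg.eval_ofCTerm] at this
  · intro hu
    have hinj : Function.Injective fun i : Fin n => Infinite.natEmbedding V i :=
      fun i j h => Fin.ext ((Infinite.natEmbedding V).injective h)
    have hθ := fun i => hinj.extend_apply ts (fun _ => CTerm.bot) i
    refine ⟨Function.extend (fun i : Fin n => Infinite.natEmbedding V i) ts fun _ => CTerm.bot,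
      fun i => (hθ i).le, fun p hp => hp.elim, ts, fun i => ?_, hu⟩
    change ts i ∈ A.eval CTerm.var (Term.ofCTerm _)
    rw [TAlg.eval_ofCTerm]
    exact (hθ i).ge

namespace Program

theorem mem_T_union {P Q : Program C F V} {A : TAlg C F V} {n : ℕ} {f : F n}
    {ts : Fin n → CTerm C V} {u : CTerm C V} : u ∈ (T (P ∪ Q) A).interp f ts ↔
      u ∈ (P.T A).interp f ts ∨ u ∈ (Q.T A).interp f ts := by
  simp only [mem_T, Set.mem_union, or_and_right, exists_or]
  exact or_or_distrib_right

theorem mem_T_empty {A : TAlg C F V} {n : ℕ} {f : F n} {ts : Fin n → CTerm C V} {u : CTerm C V} :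
    u ∈ (T (∅ : Program C F V) A).interp f ts ↔ u = CTerm.bot := by
  simp [mem_T]

theorem mem_T_delete {P : Program C F V} {σ : SubSig F} {A : TAlg C F V} {n : ℕ} {f : F n}
    {ts : Fin n → CTerm C V} {u : CTerm C V} : u ∈ ((P.delete σ).T A).interp f ts ↔
      (f ∉ σ n ∧ u ∈ (P.T A).interp f ts) ∨ u = CTerm.bot := by
  simp only [mem_T, delete, Set.mem_ofPred_eq]
  grind

/-- The mapping need not be injective: every symbol `g` sent to `f` contributes its values. -/
theorem mem_T_map {F' : ℕ → Type x} {φ : ∀ n, F n → F' n} {P : Program C F V} {A : TAlg C F' V}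
    {n : ℕ} {f : F' n} {ts : Fin n → CTerm C V} {u : CTerm C V} :
    u ∈ ((P.map φ).T A).interp f ts ↔
      (∃ g, φ n g = f ∧ u ∈ (P.T (A.comap φ)).interp g ts) ∨ u = CTerm.bot := by
  constructor
  · intro hu
    rcases mem_T.1 hu with ⟨R, ⟨⟨m, g, R'⟩, hR', h⟩, hy⟩ | h
    · cases h
      exact Or.inl ⟨g, rfl, mem_T.2 (Or.inl ⟨R', hR', Rule.yields_map.1 hy⟩)⟩
    · exact Or.inr h
  · rintro (⟨g, rfl, hu⟩ | h)
    · rcases mem_T.1 hu with ⟨R, hR, hy⟩ | h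
      · exact mem_T.2 (Or.inl ⟨R.map φ, ⟨⟨n, g, R⟩, hR, rfl⟩, Rule.yields_map.2 hy⟩)
      · exact mem_T.2 (Or.inr h)
    · exact mem_T.2 (Or.inr h)

/-- Injectivity prevents rules of different symbols from merging. -/
theorem comap_T_map {F' : ℕ → Type x} {φ : ∀ n, F n → F' n}
    (hφ : ∀ n, Function.Injective (φ n)) (P : Program C F V) (A : TAlg C F' V) :
    ((P.map φ).T A).comap φ = P.T (A.comap φ) := by
  ext n f ts u
  change u ∈ ((P.map φ).T A).interp (φ n f) ts ↔ _
  rw [mem_T_map]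
  constructor
  · rintro (⟨g, hg, hu⟩ | rfl)
    · rwa [← hφ n hg]
    · exact TAlg.bot_mem_interp _ f ts
  · exact fun hu => Or.inl ⟨f, rfl, hu⟩

theorem comap_Tω_map {F' : ℕ → Type x} {φ : ∀ n, F n → F' n}
    (hφ : ∀ n, Function.Injective (φ n)) (P : Program C F V) :
    (P.map φ).Tω.comap φ = P.Tω := by
  have hk : ∀ k, ((P.map φ).T^[k] TAlg.bot).comap φ = P.T^[k] TAlg.bot := fun k => by
    induction k with
    | zero => rfl
    | succ k ih => rw [Function.iterate_succ_apply', comap_T_map hφ, ih,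
        Function.iterate_succ_apply']
  exact congrArg TAlg.seqSup (funext hk)

/-- The embeddings `s` and `t` are left general so as to serve both `visibleExt` and `starHidden`.
-/
theorem mem_T_bridge [Infinite V] {Ω : Type x} {F' : ℕ → Type*} {s : ∀ n, F n → F' n}
    {t : ∀ n, Ω × F n → F' n} {B : Set (Bridge Ω F)} {A : TAlg C F' V} {n : ℕ} {f : F' n}
    {ts : Fin n → CTerm C V} {u : CTerm C V} :
    u ∈ (T ((fun b : Bridge Ω F => ⟨b.arity, s b.arity b.source,
        forwardRule (s b.arity b.source) (t b.arity (b.label, b.target))⟩) '' B :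
          Program C F' V) A).interp f ts ↔
      (∃ g L g', ⟨n, g, L, g'⟩ ∈ B ∧ s n g = f ∧ u ∈ A.interp (t n (L, g')) ts) ∨
        u = CTerm.bot := by
  constructor
  · intro hu
    rcases mem_T.1 hu with ⟨R, ⟨⟨m, g, L, g'⟩, hb, h⟩, hy⟩ | h
    · cases h
      exact Or.inl ⟨g, L, g', hb, rfl, Rule.yields_forwardRule.1 hy⟩
    · exact Or.inr h
  · rintro (⟨g, L, g', hb, rfl, hu⟩ | h)
    · exact mem_T.2 (Or.inl ⟨_, ⟨_, hb, rfl⟩, Rule.yields_forwardRule.2 hu⟩)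
    · exact mem_T.2 (Or.inr h)

end Program

/-! ### The transformer of a structured module -/

namespace StructuredModule

variable {Ω : Type x}

/-- Hidden rules define labeled symbols only, so their least model is ⊥ on visible ones. -/
theorem comap_inl_background [Infinite V] (M : StructuredModule Ω C F V) (A : TAlg C F V) :
    (M.hiddenExt.Tω.sup (A.extend Ω)).comap (fun _ => Sum.inl) = A := by
  ext n f ts u
  constructor
  · rintro (hu | hu)
    · rw [← Program.T_Tω] at hu
      rcases Program.mem_T_map.1 hu with ⟨g, hg, -⟩ | rfl
      · cases hg
      · exact A.bot_mem_interp f ts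
    · exact hu
  · exact fun hu => Or.inr hu

/-- Extending `A` adds only ⊥ at labels, and hidden rules call labeled symbols only, so their model
does not depend on the visible signature. -/
theorem background_inr (M : StructuredModule Ω C F V) (A : TAlg C F V) {n : ℕ} (f : Ω × F n)
    (ts : Fin n → CTerm C V) :
    (M.hiddenExt.Tω.sup (A.extend Ω)).interp (Sum.inr f : ExtSig Ω F n) ts =
      M.hidden.Tω.interp f ts := by
  rw [← Program.comap_Tω_map (φ := fun _ => (Sum.inr : _ → ExtSig Ω F _))
    (fun _ => Sum.inr_injective)]
  refine Set.union_eq_left.2 fun u hu => ?_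
  exact TAlg.bot_le' M.hiddenExt.Tω n (Sum.inr f : ExtSig Ω F n) ts hu

theorem mem_U [Infinite V] {M : StructuredModule Ω C F V} {A : TAlg C F V} {n : ℕ} {f : F n}
    {ts : Fin n → CTerm C V} {u : CTerm C V} : u ∈ (M.U A).interp f ts ↔
      u ∈ (M.visible.T A).interp f ts ∨
        ∃ L g, ⟨n, f, L, g⟩ ∈ M.bridge ∧ u ∈ M.hidden.Tω.interp (L, g) ts := by
  change u ∈ (M.visibleExt.T _).interp (Sum.inl f : ExtSig Ω F n) ts ↔ _
  rw [visibleExt, Program.mem_T_union, Program.mem_T_map,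
    Program.mem_T_bridge (s := fun _ => Sum.inl) (t := fun _ => Sum.inr), comap_inl_background]
  simp only [background_inr, Sum.inl.injEq]
  constructor
  · rintro ((⟨g, rfl, hu⟩ | rfl) | ⟨g, L, g', hb, rfl, hu⟩ | rfl)
    · exact Or.inl hu
    · exact Or.inl (TAlg.bot_mem_interp _ f ts)
    · exact Or.inr ⟨L, g', hb, hu⟩
    · exact Or.inl (TAlg.bot_mem_interp _ f ts)
  · rintro (hu | ⟨L, g', hb, hu⟩)
    · exact Or.inl (Or.inl ⟨f, rfl, hu⟩)
    · exact Or.inr (Or.inl ⟨f, L, g', hb, rfl, hu⟩)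

theorem mem_T_starHidden [Infinite V] {M : StructuredModule Ω C F V} {L : Ω}
    {A : TAlg C (LabSig Ω F) V} {n : ℕ} {f : Ω × F n} {ts : Fin n → CTerm C V} {u : CTerm C V} :
    u ∈ ((M.starHidden L).T A).interp f ts ↔
      (f.1 = L ∧ (u ∈ (M.visible.T (A.comap fun _ g => (L, g))).interp f.2 ts ∨
        ∃ L' g, ⟨n, f.2, L', g⟩ ∈ M.bridge ∧ u ∈ A.interp (L', g) ts)) ∨
      u ∈ (M.hidden.T A).interp f ts := by
  rw [starHidden, Program.mem_T_union, Program.mem_T_union, Program.mem_T_map,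
    Program.mem_T_bridge (s := fun _ g => (L, g)) (t := fun _ g => g)]
  constructor
  · rintro (((⟨g, rfl, hu⟩ | rfl) | ⟨g, L', g', hb, rfl, hu⟩ | rfl) | hu)
    · exact Or.inl ⟨rfl, Or.inl hu⟩
    -- The value ⊥ also arises at symbols with a label other than `L`, so it is charged to the
    -- hidden part.
    · exact Or.inr (TAlg.bot_mem_interp (M.hidden.T A) f ts)
    · exact Or.inl ⟨rfl, Or.inr ⟨L', g', hb, hu⟩⟩
    · exact Or.inr (TAlg.bot_mem_interp (M.hidden.T A) f ts)
    · exact Or.inr hu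
  · obtain ⟨L₀, f⟩ := f
    rintro (⟨rfl, hu | ⟨L', g', hb, hu⟩⟩ | hu)
    · exact Or.inl (Or.inl (Or.inl ⟨f, rfl, hu⟩))
    · exact Or.inl (Or.inr (Or.inl ⟨f, L', g', hb, rfl, hu⟩))
    · exact Or.inr hu

/-! ### Finiteness -/

/-- Each new bridge comes from an exported symbol, hence from one of the finitely many visible or
bridge rules. -/
theorem Finite.star [Infinite V] {M : StructuredModule Ω C F V} (hM : M.Finite) (L : Ω) :
    (M.star L).Finite := by
  obtain ⟨hv, hb, hh⟩ := hM
  refine ⟨Set.finite_empty, ?_, ((hv.image _).union (hb.image _)).union hh⟩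
  refine ((hv.image fun R => (⟨R.1, R.2.1, L, R.2.1⟩ : Bridge Ω F)).union
    (hb.image fun b => (⟨b.arity, b.source, L, b.source⟩ : Bridge Ω F))).subset ?_
  rintro ⟨n, f, l, g⟩ ⟨hf, hl, hg⟩
  dsimp only at hf hl hg
  subst hl hg
  rcases hf with ⟨R, hR⟩ | ⟨L', g', hb'⟩
  · exact Or.inl ⟨_, hR, rfl⟩
  · exact Or.inr ⟨_, hb', rfl⟩

end StructuredModule

/-! ### The representation morphism -/

namespace ModExpr

variable {N : Type x} [Infinite V] (Γ : N → Program C F V)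

theorem impl_finite (hΓ : ∀ a, (Γ a).Finite) (E : ModExpr N F) : (E.impl Γ).Finite := by
  induction E with
  | name a => exact ⟨hΓ a, Set.finite_empty, Set.finite_empty⟩
  | union E₁ E₂ ih₁ ih₂ =>
    exact ⟨ih₁.1.union ih₂.1, ih₁.2.1.union ih₂.2.1, ih₁.2.2.union ih₂.2.2⟩
  | delete E σ ih => exact ⟨ih.1.subset fun _ h => h.1, ih.2.1.subset fun _ h => h.1, ih.2.2⟩
  | rename ρ E ih => exact ⟨ih.1.image _, ih.2.1.image _, ih.2.2⟩
  | closure E ih => exact ih.star E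

/-- The transformer of the flat module, in terms of the visible and bridge rules of the
implementation, when the labeled symbol `L.g` stands for `g` in the least model of `L`. -/
theorem mem_T_flat (E : ModExpr N F) (A : TAlg C F V) {n : ℕ} (f : F n) (ts : Fin n → CTerm C V)
    (u : CTerm C V) : u ∈ ((E.flat Γ).T A).interp f ts ↔
      u ∈ ((E.impl Γ).visible.T A).interp f ts ∨
        ∃ L g, ⟨n, f, L, g⟩ ∈ (E.impl Γ).bridge ∧ u ∈ (L.flat Γ).Tω.interp g ts := by
  -- The algebra must vary, because renaming evaluates the inner expression in `A.comap ρ`.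
  induction E generalizing A n u with
  | name a => simp [flat, impl, StructuredModule.ofPlain]
  | union E₁ E₂ ih₁ ih₂ =>
    simp only [flat, impl, StructuredModule.union, Program.mem_T_union, ih₁, ih₂, Set.mem_union,
      or_and_right, exists_or]
    exact or_or_or_comm
  | delete E σ ih =>
    simp only [flat, impl, StructuredModule.delete, Program.mem_T_delete, ih, Set.mem_ofPred_eq]
    grind
  | rename ρ E ih =>
    simp only [flat, impl, StructuredModule.rename, Program.mem_T_map, ih]
    constructor
    · rintro (⟨g, rfl, hu | ⟨L, g', hb, hu⟩⟩ | rfl)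
      · exact Or.inl (Or.inl ⟨g, rfl, hu⟩)
      · exact Or.inr ⟨L, g', ⟨_, hb, rfl⟩, hu⟩
      · exact Or.inl (Or.inr rfl)
    · rintro ((⟨g, rfl, hu⟩ | rfl) | ⟨L, g', ⟨⟨m, g, L₁, g₁⟩, hb, h⟩, hu⟩)
      · exact Or.inl ⟨g, rfl, Or.inl hu⟩
      · exact Or.inr rfl
      · cases h
        exact Or.inl ⟨_, rfl, Or.inr ⟨_, _, hb, hu⟩⟩
  | closure E ih =>
    simp only [flat, impl, StructuredModule.star, Program.T_closure, Program.mem_T_empty]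
    constructor
    · intro hu
      by_cases hf : f ∈ (E.impl Γ).exp n
      · exact Or.inr ⟨E, f, ⟨hf, rfl, rfl⟩, hu⟩
      -- Without a bridge for `f` only ⊥ is possible: the least model is a fixpoint, and the
      -- induction hypothesis applied to it leaves no rule of `f` to produce a value.
      · rw [← Program.T_Tω, ih] at hu
        rcases hu with hu | ⟨L, g, hb, -⟩
        · exact Or.inl (Program.eq_bot_of_notMem_exp (fun h => hf (Or.inl h)) hu)
        · exact (hf (Or.inr ⟨L, g, hb⟩)).elim
    · rintro (rfl | ⟨L, g, ⟨-, hL, hg⟩, hu⟩)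
      · exact TAlg.bot_mem_interp _ f ts
      · dsimp only at hL hg
        subst hL hg
        exact hu

/-- The algebra where each labeled symbol `L.g` is interpreted as `g` in the least model of the
module denoted by `L`. -/
def labelAlg : TAlg C (LabSig (ModExpr N F) F) V where
  interp f ts := (f.1.flat Γ).Tω.interp f.2 ts
  nonempty f := (f.1.flat Γ).Tω.nonempty f.2
  isLowerSet f := (f.1.flat Γ).Tω.isLowerSet f.2
  mono f := (f.1.flat Γ).Tω.mono f.2

/-- Labels are the expressions themselves, so one algebra interprets them all and unions of hidden
parts cannot interfere. For a closure, the new rules at label E compute T_E at its own fixpoint. -/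
theorem T_hidden_labelAlg_le (E : ModExpr N F) :
    (E.impl Γ).hidden.T (labelAlg Γ) ≤ labelAlg Γ := by
  induction E with
  | name a =>
    intro n f ts u hu
    obtain rfl := Program.mem_T_empty.1 hu
    exact TAlg.bot_mem_interp _ f ts
  | union E₁ E₂ ih₁ ih₂ =>
    intro n f ts u hu
    exact (Program.mem_T_union.1 hu).elim (fun h => ih₁ n f ts h) fun h => ih₂ n f ts h
  | delete E σ ih => exact ih
  | rename ρ E ih => exact ih
  | closure E ih =>
    rintro n ⟨L, f⟩ ts u hu
    rcases StructuredModule.mem_T_starHidden.1 hu with ⟨rfl, hu⟩ | hu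
    · change u ∈ (L.flat Γ).Tω.interp f ts
      rw [← Program.T_Tω]
      exact (mem_T_flat Γ L _ f ts u).2 hu
    · exact ih n _ ts hu

/-- `H` is general because the hidden rules of a subexpression are only part of the final ones. Only
bridge targets are considered: a label without hidden rules would have only the value ⊥. -/
theorem Tω_flat_subset_hidden (E : ModExpr N F) {H : Program C (LabSig (ModExpr N F) F) V}
    (hH : (E.impl Γ).hidden ⊆ H) :
    ∀ b ∈ (E.impl Γ).bridge, ∀ ts, (b.label.flat Γ).Tω.interp b.target ts ⊆
      H.Tω.interp (b.label, b.target) ts := by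
  induction E with
  | name a => exact fun b hb => hb.elim
  | union E₁ E₂ ih₁ ih₂ =>
    rintro b (hb | hb)
    · exact ih₁ (Set.subset_union_left.trans hH) b hb
    · exact ih₂ (Set.subset_union_right.trans hH) b hb
  | delete E σ ih => exact fun b hb => ih hH b hb.1
  | rename ρ E ih =>
    rintro _ ⟨b, hb, rfl⟩
    exact ih hH b hb
  | closure E ih =>
    -- By leastness it suffices that `H.Tω`, read at label `E`, is closed under the flat
    -- transformer. The relabeled visible and bridge rules in `H` provide this, with the induction
    -- hypothesis covering the inner bridges.
    have hle : (E.flat Γ).Tω ≤ H.Tω.comap fun _ g => (E, g) := by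
      refine Program.Tω_le fun n f ts u hu => ?_
      have hstar : ∀ {u}, u ∈ (((E.impl Γ).starHidden E).T H.Tω).interp (E, f) ts →
          u ∈ H.Tω.interp (E, f) ts := fun {u} hu => by
        rw [← Program.T_Tω]
        exact Program.mem_T.2 ((Program.mem_T.1 hu).imp_left fun ⟨R, hR, h⟩ => ⟨R, hH hR, h⟩)
      refine hstar (StructuredModule.mem_T_starHidden.2 (Or.inl ⟨rfl, ?_⟩))
      refine ((mem_T_flat Γ E _ f ts u).1 hu).imp_right ?_
      rintro ⟨L, g, hb, hu⟩
      exact ⟨L, g, hb, ih (Set.subset_union_right.trans hH) _ hb ts hu⟩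
    rintro ⟨n, f, L, g⟩ ⟨-, hL, hg⟩ ts
    dsimp only at hL hg ⊢
    subst hL hg
    exact hle n _ ts

theorem T_flat_eq_U (E : ModExpr N F) (A : TAlg C F V) : (E.flat Γ).T A = (E.impl Γ).U A := by
  ext n f ts u
  rw [mem_T_flat, StructuredModule.mem_U]
  refine or_congr_right (exists_congr fun L => exists_congr fun g => and_congr_right fun hb => ?_)
  exact ⟨fun hu => Tω_flat_subset_hidden Γ E subset_rfl _ hb ts hu,
    fun hu => Program.Tω_le (T_hidden_labelAlg_le Γ E) n (L, g) ts hu⟩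

end ModExpr

end CRWL

theorem mainTheorem9 {C : ℕ → Type u} {F : ℕ → Type v} {V : Type w} [Infinite V] {N : Type x}
    (Γ : N → CRWL.Program C F V) (hΓ : ∀ a, (Γ a).Finite) (E : CRWL.ModExpr N F) :
    (E.impl Γ).Finite ∧
      (∀ A : CRWL.TAlg C F V, A.Consistent → ((E.impl Γ).U A).Consistent) ∧
      ∀ A : CRWL.TAlg C F V, (E.flat Γ).T A = (E.impl Γ).U A := by
  exact ⟨CRWL.ModExpr.impl_finite Γ hΓ E,
    fun A hA => CRWL.ModExpr.T_flat_eq_U Γ E A ▸ (E.flat Γ).T_consistent hA,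
    CRWL.ModExpr.T_flat_eq_U Γ E⟩
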